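/- Let $n\ge 6$ be an even integer, let $\varphi:\mathbb{R}^n\to\mathbb{R}$ be a polynomial with $\varphi\le 0$ on $\mathbb{R}^n$, and put $Q=(n-1)!+\varphi$. If $4\le\deg\varphi\le n-2$, assume in addition that, up to a rotation or a translation of the coordinates, $x\cdot\nabla\varphi\ge(\deg\varphi)\varphi$; that is, there is an isometry $T$ of $\mathbb{R}^n$ such that $\psi=\varphi\circ T$ satisfies $$x\cdot\nabla\psi(x)\ \ge\ (\deg\varphi)\,\psi(x)\qquad\text{for all }x\in\mathbb{R}^n .$$ Let $u\in C^\infty(\mathbb{R}^n)$ be a normal solution of $(-\Delta)^{n/2}u=Qe^{nu}$ on $\mathbb{R}^n$; that is, $Qe^{nu}\in L^1(\mathbb{R}^n)$, $u$ satisfies this equation, and for some constant $C\in\mathbb{R}$ $$u(x)=\frac{2}{(n-1)!\,|\mathbb{S}^n|}\int_{\mathbb{R}^n}\log\frac{|y|}{|x-y|}\,Q(y)e^{nu(y)}\,dy+C\qquad\text{for all }x\in\mathbb{R}^n,$$ where $|\mathbb{S}^n|$ is the volume of the standard unit $n$-sphere. Then $$\int_{\mathbb{R}^n}e^{nu}\,dx\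 \ge\ |\mathbb{S}^n|$$ (the integral may be $+\infty$), and equality holds if and only if $\varphi\equiv 0$. -/

import Mathlib

open MeasureTheory
open scoped ContDiff Laplacian Gradient

namespace QCurvature

/-- Euclidean `n`-space, with its Euclidean norm. -/
abbrev Euc (n : ℕ) : Type := EuclideanSpace ℝ (Fin n)

/-- The total surface measure `|𝕊ⁿ|` of the unit sphere of `ℝⁿ⁺¹` (a finite number). -/
noncomputable def sphereVol (n : ℕ) : ENNReal :=
  (volume : Measure (Euc (n + 1))).toSphere Set.univ

/-- The polyharmonic operator `(-Δ)ᵏ`, as the `k`-th iterate of `f ↦ -Δ f`. -/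
noncomputable def negLaplacianPow {n : ℕ} (k : ℕ) (u : Euc n → ℝ) : Euc n → ℝ :=
  (fun f : Euc n → ℝ => -(Δ f))^[k] u

/-- `u` is a (smooth) normal solution, for the smooth Q-curvature `Q`, of
`(-Δ)^{n/2} u = Q e^{nu}` on `ℝⁿ` (`n` even): `Q e^{nu}` is integrable, the equation holds,
and `u(x) = 2 / ((n-1)! |𝕊ⁿ|) ∫ log (|y| / |x - y|) Q(y) e^{n u(y)} dy + C` for a constant `C`.
For fixed `x` the kernel `log (|y| / |x - y|)` is bounded off a compact set and locally integrable,
so the integrand is integrable as soon as `Q e^{nu}` is integrable and continuous. -/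
structure IsNormalSolution (n : ℕ) (Q u : Euc n → ℝ) : Prop where
  smooth_curvature : ContDiff ℝ ∞ Q
  smooth : ContDiff ℝ ∞ u
  integrable : Integrable (fun x => Q x * Real.exp (n * u x)) volume
  equation : ∀ x, negLaplacianPow (n / 2) u x = Q x * Real.exp (n * u x)
  normal : ∃ C : ℝ, ∀ x, u x =
    2 / ((Nat.factorial (n - 1) : ℝ) * (sphereVol n).toReal) *
      (∫ y, Real.log (‖y‖ / ‖x - y‖) * (Q y * Real.exp (n * u y))) + C

/-- The function on `ℝⁿ` given by a real polynomial in `n` variables. -/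
noncomputable def polyFun {n : ℕ} (p : MvPolynomial (Fin n) ℝ) (x : Euc n) : ℝ :=
  MvPolynomial.eval (fun i => x i) p

/-- After a rigid motion `T` of the coordinates, `ψ = φ ∘ T` satisfies
`x · ∇ψ(x) ≥ (deg φ) ψ(x)` for all `x`. -/
def HomogeneityCondition {n : ℕ} (φ : MvPolynomial (Fin n) ℝ) : Prop :=
  ∃ T : Euc n ≃ᵃⁱ[ℝ] Euc n, ∀ x : Euc n,
    (φ.totalDegree : ℝ) * polyFun φ (T x) ≤ inner ℝ x (∇ (fun z => polyFun φ (T z)) x)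

end QCurvature

namespace QCurvature

open Metric Filter Topology

variable {n : ℕ}

/-! Write `F = (n-1)!`, `S = |𝕊ⁿ|`, `f = Q e^{nu}`, `Λ = ∫ f`, `t = Λ / (F S)`, `V = ∫ e^{nu}`, `P =
∫ φ e^{nu} ≤ 0` and `d = deg φ`, so that `Λ = F V + P`. If `V` is infinite the claim is immediate,
since `φ = 0` would make `e^{nu}` a multiple of the integrable `f`. If `V` is finite, two facts
about the logarithmic potential suffice.

Decay (`add_le_of_integrable_weight`): averages of `u` over balls dilated by `R` behave like `-2t
log R`. Since `-φ` grows like `R^d` in some cone and `φ e^{nu}` is integrable, Jensen's inequality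
gives `n + d ≤ 2nt`.

Pohozaev (`pohozaev_le`): testing with the dilation field about a point `p` gives `d P ≤ n F S t (t
- 1)`, provided that `(x - p) · ∇φ ≥ d φ`. Such a centre exists by hypothesis for `4 ≤ d ≤ n - 2`. A
nonpositive polynomial has even degree, so below 4 only constants and quadratics remain, and a
nonpositive quadratic has a critical point that serves as centre (`IsQuadraticFun.exists_center`).

The conclusion is algebra (`volume_comparison`). If `t ≥ 1`, then `F V = t F S - P ≥ F S`. If `t <
1`, decay forces `d < n` and `nt > d`, and Pohozaev gives `d F (V - S) ≥ F S (1 - t)(nt - d) > 0`.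
Equality therefore forces `P = 0`, hence `φ = 0`; conversely, for `φ = 0` the Pohozaev identity
reads `t (t - 1) = 0`, so `t = 1` and `V = S`. -/

lemma nontrivial_euc (hn : 2 ≤ n) : Nontrivial (Euc n) := by
  apply Module.nontrivial_of_finrank_pos (R := ℝ)
  simp only [finrank_euclideanSpace, Fintype.card_fin]; omega

/-! ### Integrability against the kernels `1 / |x - y|` and `log (|y| / |x - y|)`. -/

lemma integrableOn_norm_inv_ball (hn : 2 ≤ n) :
    IntegrableOn (fun z : Euc n => ‖z‖⁻¹) (ball 0 1) := by
  have := nontrivial_euc hn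
  rw [integrableOn_fun_norm_addHaar volume (f := fun r : ℝ => r⁻¹)]
  have hI : IntegrableOn (fun _ : ℝ => (1 : ℝ)) (Set.Ioo (0 : ℝ) 1) := by
    simp [integrableOn_const_iff]
  refine Integrable.mono' hI ?_ ?_
  · exact (by fun_prop : Measurable fun y : ℝ =>
      y ^ (Module.finrank ℝ (Euc n) - 1) • y⁻¹).aestronglyMeasurable
  · refine (ae_restrict_iff' measurableSet_Ioo).2 (Eventually.of_forall fun y hy => ?_)
    obtain ⟨k, rfl⟩ := Nat.exists_eq_add_of_le' hn
    have h0 := hy.1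
    simp only [finrank_euclideanSpace, Fintype.card_fin, smul_eq_mul, norm_mul, norm_pow, norm_inv,
      Real.norm_eq_abs, abs_of_pos h0]
    have : y ^ (k + 2 - 1) * y⁻¹ = y ^ k := by
      rw [show k + 2 - 1 = k + 1 by omega, pow_succ]; field_simp
    rw [this]
    exact pow_le_one₀ h0.le hy.2.le

/-- The integral of `1 / |z|` over the unit ball. -/
noncomputable def ballNewton (n : ℕ) : ℝ := ∫ z : Euc n in ball 0 1, ‖z‖⁻¹

lemma ballNewton_nonneg : 0 ≤ ballNewton n :=
  integral_nonneg fun _ => by positivity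

/-- Inside the unit ball about `y` one bounds `g` by `M`; outside it the kernel is at most 1. The
resulting bound depends on `y` only through `M`, so a globally bounded `g` gives a uniform estimate,
as Tonelli requires. -/
lemma integrable_mul_norm_sub_inv (hn : 2 ≤ n) {g : Euc n → ℝ} (hg : Integrable g) {y : Euc n}
    {M : ℝ} (hM : ∀ x ∈ ball y 1, |g x| ≤ M) :
    Integrable (fun x => g x * ‖x - y‖⁻¹) ∧
      ∫ x, |g x| * ‖x - y‖⁻¹ ≤ M * ballNewton n + ∫ x, |g x| := by
  set b : Euc n → ℝ := (ball (0 : Euc n) 1).indicator fun z => ‖z‖⁻¹ with hb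
  have hbi : Integrable b := (integrable_indicator_iff measurableSet_ball).2
    (integrableOn_norm_inv_ball hn)
  have hdom : Integrable fun x => M * b (x - y) + |g x| :=
    ((hbi.comp_sub_right y).const_mul M).add hg.abs
  have hle : ∀ x, |g x| * ‖x - y‖⁻¹ ≤ M * b (x - y) + |g x| := by
    intro x
    by_cases hx : x ∈ ball y 1
    · have hx' : x - y ∈ ball (0 : Euc n) 1 := by simpa [dist_eq_norm] using hx
      rw [hb, Set.indicator_of_mem hx']
      have := mul_le_mul_of_nonneg_right (hM x hx) (inv_nonneg.2 (norm_nonneg (x - y)))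
      linarith [abs_nonneg (g x)]
    · have hx' : x - y ∉ ball (0 : Euc n) 1 := by simpa [dist_eq_norm] using hx
      rw [hb, Set.indicator_of_notMem hx']
      have h1 : ‖x - y‖⁻¹ ≤ 1 := inv_le_one_of_one_le₀ (by simpa [dist_eq_norm] using hx)
      have := mul_le_mul_of_nonneg_left h1 (abs_nonneg (g x))
      linarith
  have hint : Integrable fun x => g x * ‖x - y‖⁻¹ := by
    refine hdom.mono' (hg.aestronglyMeasurable.mul
      (by fun_prop : Measurable fun x => ‖x - y‖⁻¹).aestronglyMeasurable) (ae_of_all _ fun x => ?_)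
    simpa [abs_mul] using hle x
  refine ⟨hint, ?_⟩
  calc ∫ x, |g x| * ‖x - y‖⁻¹ ≤ ∫ x, (M * b (x - y) + |g x|) := by
        refine integral_mono ?_ hdom hle
        simpa [abs_mul] using hint.abs
    _ = M * ballNewton n + ∫ x, |g x| := by
        rw [integral_add ((hbi.comp_sub_right y).const_mul M) hg.abs, integral_const_mul,
          integral_sub_right_eq_self b y, hb, integral_indicator measurableSet_ball, ballNewton]

lemma integrable_prod_mul_norm_sub_inv (hn : 2 ≤ n) {f g : Euc n → ℝ} (hf : Integrable f)
    (hg : Integrable g) {M : ℝ} (hM : ∀ x, |g x| ≤ M) {a : Euc n → Euc n} (ha : Measurable a) :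
    Integrable (fun q : Euc n × Euc n => g q.1 * f q.2 * ‖q.1 - a q.2‖⁻¹)
      (volume.prod volume) := by
  have hmeas : AEStronglyMeasurable (fun q : Euc n × Euc n => g q.1 * f q.2 * ‖q.1 - a q.2‖⁻¹)
      (volume.prod volume) := by
    refine (hg.aestronglyMeasurable.comp_fst.mul hf.aestronglyMeasurable.comp_snd).mul ?_
    exact (by fun_prop : Measurable fun q : Euc n × Euc n => ‖q.1 - a q.2‖⁻¹).aestronglyMeasurable
  rw [integrable_prod_iff' hmeas]
  constructor
  · refine ae_of_all _ fun y => ?_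
    have := ((integrable_mul_norm_sub_inv hn hg (y := a y) fun x _ => hM x).1).const_mul (f y)
    refine this.congr (ae_of_all _ fun x => ?_)
    simp only; ring
  · refine (hf.abs.mul_const (M * ballNewton n + ∫ x, |g x|)).mono' (hmeas.norm.prod_swap.integral_prod_right')
      (ae_of_all _ fun y => ?_)
    have h2 := (integrable_mul_norm_sub_inv hn hg (y := a y) fun x _ => hM x).2
    have h3 : ∫ x, ‖g x * f y * ‖x - a y‖⁻¹‖ = |f y| * ∫ x, |g x| * ‖x - a y‖⁻¹ := by
      rw [← integral_const_mul]
      congr 1; ext x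
      simp only [norm_mul, norm_inv, Real.norm_eq_abs, abs_norm]; ring
    have h4 : 0 ≤ ∫ x, |g x| * ‖x - a y‖⁻¹ := integral_nonneg fun x => by positivity
    rw [h3, Real.norm_eq_abs, abs_of_nonneg (by positivity)]
    exact mul_le_mul_of_nonneg_left h2 (abs_nonneg _)

lemma integrable_mul_norm_inv_of_continuous (hn : 2 ≤ n) {f : Euc n → ℝ} (hf : Integrable f)
    (hc : Continuous f) : Integrable fun y => f y * ‖y‖⁻¹ := by
  obtain ⟨M, hM⟩ := (isCompact_closedBall (0 : Euc n) 1).exists_bound_of_continuousOn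
    hc.continuousOn
  have := (integrable_mul_norm_sub_inv hn hf (y := 0) (M := M)
    fun x hx => hM x (ball_subset_closedBall hx)).1
  simpa using this

/-- This is `log s ≤ s - 1` applied to `a / b` and to `b / a`. It controls the logarithmic kernel by
`1 / |y|` and `1 / |x - y|` with a factor `|x|`, so no separate analysis at infinity in `y` is
needed. -/
lemma abs_log_div_le {a b : ℝ} (ha : 0 ≤ a) (hb : 0 ≤ b) :
    |Real.log (a / b)| ≤ |a - b| * (a⁻¹ + b⁻¹) := by
  rcases ha.eq_or_lt with rfl | ha
  · simp; positivity
  rcases hb.eq_or_lt with rfl | hb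
  · simp; positivity
  have key : ∀ a b : ℝ, 0 < a → 0 < b → Real.log (a / b) ≤ |a - b| * (a⁻¹ + b⁻¹) := by
    intro a b ha hb
    have h1 := Real.log_le_sub_one_of_pos (div_pos ha hb)
    have h2 : a / b - 1 = (a - b) * b⁻¹ := by field_simp
    have h3 : (a - b) * b⁻¹ ≤ |a - b| * b⁻¹ :=
      mul_le_mul_of_nonneg_right (le_abs_self _) (by positivity)
    have h4 : 0 ≤ |a - b| * a⁻¹ := by positivity
    linarith
  rw [abs_le']
  refine ⟨key a b ha hb, ?_⟩
  have := key b a hb ha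
  rw [← Real.log_inv, inv_div]
  rw [abs_sub_comm, add_comm]; exact this

/-- The kernel `log (|y| / |x - y|)` of normal solutions. -/
noncomputable def logKernel (x y : Euc n) : ℝ := Real.log (‖y‖ / ‖x - y‖)

lemma measurable_logKernel : Measurable fun q : Euc n × Euc n => logKernel q.1 q.2 := by
  unfold logKernel; fun_prop

lemma abs_logKernel_le (x y : Euc n) : |logKernel x y| ≤ ‖x‖ * (‖y‖⁻¹ + ‖x - y‖⁻¹) := by
  refine (abs_log_div_le (norm_nonneg _) (norm_nonneg _)).trans ?_
  refine mul_le_mul_of_nonneg_right ?_ (by positivity)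
  have := abs_norm_sub_norm_le y (y - x)
  rw [norm_sub_rev x y]
  simpa using this

lemma integrable_prod_logKernel (hn : 2 ≤ n) {f g : Euc n → ℝ} (hf : Integrable f)
    (hfc : Continuous f) (hg : Integrable g) {M ρ : ℝ} (hM : ∀ x, |g x| ≤ M)
    (hρ : ∀ x, g x ≠ 0 → ‖x‖ ≤ ρ) :
    Integrable (fun q : Euc n × Euc n => g q.1 * (logKernel q.1 q.2 * f q.2))
      (volume.prod volume) := by
  have h1 := (hg.mul_prod (integrable_mul_norm_inv_of_continuous hn hf hfc)).norm.const_mul ρ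
  have h2 := (integrable_prod_mul_norm_sub_inv hn hf hg hM measurable_id).norm.const_mul ρ
  refine (h1.add h2).mono' (hg.aestronglyMeasurable.comp_fst.mul
    (measurable_logKernel.aestronglyMeasurable.mul hf.aestronglyMeasurable.comp_snd))
    (ae_of_all _ fun q => ?_)
  simp only [Pi.add_apply, norm_mul, norm_inv, Real.norm_eq_abs, abs_norm, id]
  by_cases hq : g q.1 = 0
  · simp [hq]
  have h3 := (abs_logKernel_le q.1 q.2).trans
    (mul_le_mul_of_nonneg_right (hρ _ hq) (by positivity))
  have h4 := mul_le_mul_of_nonneg_left h3 (mul_nonneg (abs_nonneg (g q.1)) (abs_nonneg (f q.2)))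
  linarith

/-! ### Divergence and integration by parts. -/

/-- The divergence of a vector field on Euclidean space. -/
noncomputable def divergence (W : Euc n → Euc n) (x : Euc n) : ℝ :=
  ∑ i, (fderiv ℝ W x (EuclideanSpace.single i 1)) i

lemma fderiv_apply_coord {W : Euc n → Euc n} {x : Euc n} (hW : DifferentiableAt ℝ W x) (v : Euc n)
    (i : Fin n) : fderiv ℝ (fun z => W z i) x v = (fderiv ℝ W x v) i := by
  have := ((EuclideanSpace.proj (𝕜 := ℝ) i).hasFDerivAt.comp x hW.hasFDerivAt).fderiv
  have h2 : (⇑(EuclideanSpace.proj (𝕜 := ℝ) i) ∘ W) = fun z => W z i := rfl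
  rw [h2] at this
  rw [this]; rfl

lemma sum_coord_smul_single (v : Euc n) : ∑ i, v i • EuclideanSpace.single i (1 : ℝ) = v := by
  ext j
  simp [Finset.sum_apply, Pi.single_apply]

lemma continuous_divergence {W : Euc n → Euc n} (hW : ContDiff ℝ 1 W) :
    Continuous (divergence W) := by
  unfold divergence
  refine continuous_finsetSum _ fun i _ => ?_
  have h := (hW.continuous_fderiv one_ne_zero).clm_apply
    (continuous_const (y := (EuclideanSpace.single i 1 : Euc n)))
  exact (EuclideanSpace.proj (𝕜 := ℝ) i).continuous.comp h

lemma hasCompactSupport_divergence {W : Euc n → Euc n} (hW : HasCompactSupport W) :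
    HasCompactSupport (divergence W) := by
  refine (hW.fderiv ℝ).mono fun x hx => ?_
  contrapose! hx
  simp only [Function.mem_support, not_not] at hx ⊢
  simp [divergence, hx]

lemma integral_mul_divergence {g : Euc n → ℝ} {W : Euc n → Euc n} (hg : ContDiff ℝ 1 g)
    (hW : ContDiff ℝ 1 W) (hs : HasCompactSupport W) :
    ∫ x, g x * divergence W x = -∫ x, fderiv ℝ g x (W x) := by
  have hWd : Differentiable ℝ W := hW.differentiable one_ne_zero
  have hgd : Differentiable ℝ g := hg.differentiable one_ne_zero
  have hWi : ∀ i, ContDiff ℝ 1 fun x => W x i := fun i =>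
    (EuclideanSpace.proj (𝕜 := ℝ) i).contDiff.comp hW
  have hsi : ∀ i, HasCompactSupport fun x => W x i := fun i =>
    hs.comp_left (g := fun v : Euc n => v i) rfl
  have hgc : ∀ v, Continuous fun x => fderiv ℝ g x v := fun v =>
    (hg.continuous_fderiv one_ne_zero).clm_apply continuous_const
  have hWc : ∀ i v, Continuous fun x => fderiv ℝ (fun z => W z i) x v := fun i v =>
    ((hWi i).continuous_fderiv one_ne_zero).clm_apply continuous_const
  have i1 : ∀ i, Integrable fun x => fderiv ℝ g x (EuclideanSpace.single i 1) * W x i := fun i =>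
    ((hgc _).mul (hWi i).continuous).integrable_of_hasCompactSupport (hsi i).mul_left
  have i2 : ∀ i, Integrable fun x =>
      g x * fderiv ℝ (fun z => W z i) x (EuclideanSpace.single i 1) := fun i =>
    (hg.continuous.mul (hWc i _)).integrable_of_hasCompactSupport
      (((hsi i).fderiv_apply ℝ _).mul_left)
  have i3 : ∀ i, Integrable fun x => g x * W x i := fun i =>
    (hg.continuous.mul (hWi i).continuous).integrable_of_hasCompactSupport (hsi i).mul_left
  calc ∫ x, g x * divergence W x
      = ∫ x, ∑ i, g x * fderiv ℝ (fun z => W z i) x (EuclideanSpace.single i 1) := by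
        congr 1; ext x
        rw [divergence, Finset.mul_sum]
        exact Finset.sum_congr rfl fun i _ => by rw [fderiv_apply_coord (hWd x)]
    _ = ∑ i, ∫ x, g x * fderiv ℝ (fun z => W z i) x (EuclideanSpace.single i 1) :=
        integral_finsetSum _ fun i _ => i2 i
    _ = ∑ i, -∫ x, fderiv ℝ g x (EuclideanSpace.single i 1) * W x i :=
        Finset.sum_congr rfl fun i _ =>
          integral_mul_fderiv_eq_neg_fderiv_mul_of_integrable (i1 i) (i2 i) (i3 i)
            (fun x _ => hgd x) (fun x _ => (hWi i).differentiable one_ne_zero x)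
    _ = -∫ x, fderiv ℝ g x (W x) := by
        rw [Finset.sum_neg_distrib, ← integral_finsetSum _ fun i _ => i1 i]
        congr 2; ext x
        conv_rhs => rw [← sum_coord_smul_single (W x), map_sum]
        exact Finset.sum_congr rfl fun i _ => by rw [map_smul, smul_eq_mul, mul_comm]

lemma integral_divergence {W : Euc n → Euc n} (hW : ContDiff ℝ 1 W) (hs : HasCompactSupport W) :
    ∫ x, divergence W x = 0 := by
  have := integral_mul_divergence (g := fun _ => (1 : ℝ)) contDiff_const hW hs
  simpa using this

lemma divergence_smul {g : Euc n → ℝ} {X : Euc n → Euc n} {x : Euc n}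
    (hg : DifferentiableAt ℝ g x) (hX : DifferentiableAt ℝ X x) :
    divergence (fun z => g z • X z) x = g x * divergence X x + fderiv ℝ g x (X x) := by
  have h : ∀ v, fderiv ℝ (fun z => g z • X z) x v = g x • fderiv ℝ X x v + fderiv ℝ g x v • X x := by
    intro v
    rw [fderiv_fun_smul hg hX]; rfl
  simp only [divergence, h, PiLp.add_apply, PiLp.smul_apply, smul_eq_mul, Finset.sum_add_distrib,
    Finset.mul_sum]
  congr 1
  conv_rhs => rw [← sum_coord_smul_single (X x), map_sum]
  exact Finset.sum_congr rfl fun i _ => by rw [map_smul, smul_eq_mul, mul_comm]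

/-! ### Weak derivative of the logarithm and of logarithmic potentials. -/

/-- A regularisation of `log |x - y|`. -/
noncomputable def regLog (y : Euc n) (ε : ℝ) (x : Euc n) : ℝ := Real.log (‖x - y‖ ^ 2 + ε ^ 2) / 2

lemma hasFDerivAt_regLog (y x : Euc n) {ε : ℝ} (hε : 0 < ε) :
    HasFDerivAt (regLog y ε) ((‖x - y‖ ^ 2 + ε ^ 2)⁻¹ • innerSL ℝ (x - y)) x := by
  have hp : ‖x - y‖ ^ 2 + ε ^ 2 ≠ 0 := by positivity
  have h1 : HasFDerivAt (fun x : Euc n => x - y) (ContinuousLinearMap.id ℝ (Euc n)) x :=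
    (hasFDerivAt_id x).sub_const y
  have h2 := ((h1.norm_sq.add_const (ε ^ 2)).log hp).mul_const (2⁻¹ : ℝ)
  convert! h2 using 1
  ext v
  simp; ring

lemma contDiff_regLog (y : Euc n) {ε : ℝ} (hε : 0 < ε) : ContDiff ℝ 1 (regLog y ε) := by
  unfold regLog
  refine ContDiff.div_const ?_ _
  refine ContDiff.log ?_ fun x => by positivity
  exact ((contDiff_id.sub contDiff_const).norm_sq ℝ).add contDiff_const

/-- The upper bound is `log s ≤ s - 1`; for the lower one, drop `ε²` and apply the same inequality
to `1 / |x - y|`. The bound does not involve `ε` and serves as a dominating function. -/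
lemma abs_regLog_le {y x : Euc n} {ε : ℝ} (h0 : 0 < ε) (h1 : ε ≤ 1) (hx : x ≠ y) :
    |regLog y ε x| ≤ ‖x - y‖ ^ 2 + 1 + ‖x - y‖⁻¹ := by
  have hr : 0 < ‖x - y‖ := norm_pos_iff.2 (sub_ne_zero.2 hx)
  set r := ‖x - y‖ with hr'
  have hs : 0 < r ^ 2 + ε ^ 2 := by positivity
  have hu := Real.log_le_sub_one_of_pos hs
  have hl : Real.log (r ^ 2) ≤ Real.log (r ^ 2 + ε ^ 2) :=
    Real.log_le_log (by positivity) (by nlinarith)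
  have hl2 := Real.log_le_sub_one_of_pos (inv_pos.2 hr)
  rw [Real.log_inv] at hl2
  rw [Real.log_pow] at hl
  have hinv : 0 < r⁻¹ := inv_pos.2 hr
  push_cast at hl
  rw [regLog, abs_le]
  constructor <;> nlinarith

/-- The weak derivative of `log |x - y|`. -/
lemma integral_log_mul_divergence (hn : 2 ≤ n) {W : Euc n → Euc n} (hW : ContDiff ℝ 1 W)
    (hs : HasCompactSupport W) (y : Euc n) :
    ∫ x, Real.log ‖x - y‖ * divergence W x = -∫ x, inner ℝ (x - y) (W x) * (‖x - y‖ ^ 2)⁻¹ := by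
  have := nontrivial_euc hn
  have hae : ∀ᵐ x : Euc n, x ≠ y := by
    simp [ae_iff]
  have hDc := continuous_divergence hW
  have hDs := hasCompactSupport_divergence hs
  obtain ⟨M, hM⟩ := hDc.bounded_above_of_compact_support hDs
  obtain ⟨M', hM'⟩ := hW.continuous.bounded_above_of_compact_support hs
  have hDi := hDc.integrable_of_hasCompactSupport (μ := volume) hDs
  set ε : ℕ → ℝ := fun k => 1 / ((k : ℝ) + 1) with hε
  have ε0 : ∀ k, 0 < ε k := fun k => by positivity
  have ε1 : ∀ k, ε k ≤ 1 := fun k => by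
    rw [hε]; simp only
    rw [div_le_one (by positivity)]
    have : (0 : ℝ) ≤ k := by positivity
    linarith
  have εt : Tendsto ε atTop (𝓝 0) := tendsto_one_div_add_atTop_nhds_zero_nat
  have hk : ∀ k, ∫ x, regLog y (ε k) x * divergence W x =
      -∫ x, (‖x - y‖ ^ 2 + ε k ^ 2)⁻¹ * inner ℝ (x - y) (W x) := by
    intro k
    rw [integral_mul_divergence (contDiff_regLog y (ε0 k)) hW hs]
    congr 2; ext x
    rw [(hasFDerivAt_regLog y x (ε0 k)).fderiv]
    rfl
  have sq : ∀ x, Tendsto (fun k => ‖x - y‖ ^ 2 + ε k ^ 2) atTop (𝓝 (‖x - y‖ ^ 2)) := fun x => by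
    simpa using (εt.pow 2).const_add (‖x - y‖ ^ 2)
  have t1 : Tendsto (fun k => ∫ x, regLog y (ε k) x * divergence W x) atTop
      (𝓝 (∫ x, Real.log ‖x - y‖ * divergence W x)) := by
    refine tendsto_integral_of_dominated_convergence
      (fun x => (‖x - y‖ ^ 2 + 1) * |divergence W x| + |divergence W x| * ‖x - y‖⁻¹)
      (fun k => ((contDiff_regLog y (ε0 k)).continuous.mul hDc).aestronglyMeasurable)
      ?_ (fun k => ?_) ?_
    · refine Integrable.add ?_ ?_
      · exact Continuous.integrable_of_hasCompactSupport (by fun_prop : Continuous fun x : Euc n =>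
          (‖x - y‖ ^ 2 + 1) * |divergence W x|)
            (hDs.norm.mul_left (f := fun x => ‖x - y‖ ^ 2 + 1))
      · exact (integrable_mul_norm_sub_inv hn hDi.abs (y := y) (M := M) fun x _ => by
          simpa using hM x).1
    · filter_upwards [hae] with x hx
      have := mul_le_mul_of_nonneg_right (abs_regLog_le (ε0 k) (ε1 k) hx)
        (abs_nonneg (divergence W x))
      rw [norm_mul, Real.norm_eq_abs, Real.norm_eq_abs]
      linarith
    · filter_upwards [hae] with x hx
      refine Tendsto.mul_const _ ?_
      have hr : ‖x - y‖ ^ 2 ≠ 0 := by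
        have : ‖x - y‖ ≠ 0 := norm_ne_zero_iff.2 (sub_ne_zero.2 hx)
        positivity
      have := ((sq x).log hr).div_const 2
      rw [Real.log_pow] at this
      simpa [regLog] using this
  have t2 : Tendsto (fun k => -∫ x, (‖x - y‖ ^ 2 + ε k ^ 2)⁻¹ * inner ℝ (x - y) (W x)) atTop
      (𝓝 (-∫ x, inner ℝ (x - y) (W x) * (‖x - y‖ ^ 2)⁻¹)) := by
    refine (tendsto_integral_of_dominated_convergence
      (fun x => ‖W x‖ * ‖x - y‖⁻¹) (fun k => ?_) ?_ (fun k => ?_) ?_).neg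
    · have : Continuous fun x => (‖x - y‖ ^ 2 + ε k ^ 2)⁻¹ * inner ℝ (x - y) (W x) := by
        refine Continuous.mul (Continuous.inv₀ (by fun_prop) fun x => ?_) ?_
        · have := ε0 k; positivity
        · exact (continuous_id.sub continuous_const).inner hW.continuous
      exact this.aestronglyMeasurable
    · exact (integrable_mul_norm_sub_inv hn
        (hW.continuous.integrable_of_hasCompactSupport hs).norm (y := y) (M := M') fun x _ => by
          simpa using hM' x).1
    · filter_upwards [hae] with x hx
      have hr : 0 < ‖x - y‖ := norm_pos_iff.2 (sub_ne_zero.2 hx)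
      rw [norm_mul, norm_inv, Real.norm_of_nonneg (by positivity)]
      have h1 : (‖x - y‖ ^ 2 + ε k ^ 2)⁻¹ ≤ (‖x - y‖ ^ 2)⁻¹ :=
        inv_anti₀ (by positivity) (by nlinarith [sq_nonneg (ε k)])
      have h2 := norm_inner_le_norm (𝕜 := ℝ) (x - y) (W x)
      calc _ ≤ (‖x - y‖ ^ 2)⁻¹ * (‖x - y‖ * ‖W x‖) :=
            mul_le_mul h1 h2 (norm_nonneg _) (by positivity)
        _ = ‖W x‖ * ‖x - y‖⁻¹ := by field_simp
    · filter_upwards [hae] with x hx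
      have hr : ‖x - y‖ ^ 2 ≠ 0 := by
        have : ‖x - y‖ ≠ 0 := norm_ne_zero_iff.2 (sub_ne_zero.2 hx)
        positivity
      have := ((sq x).inv₀ hr).mul_const (inner ℝ (x - y) (W x))
      rwa [mul_comm] at this
  simp only [hk] at t1
  exact tendsto_nhds_unique t1 t2

/-- Fubini. The test function `D` must be bounded with bounded support because the kernel estimate
carries a factor `‖x‖`. -/
lemma integral_mul_logPotential (hn : 2 ≤ n) {f u D : Euc n → ℝ} {c C : ℝ} (hf : Integrable f)
    (hfc : Continuous f) (hu : ∀ x, u x = c * (∫ y, logKernel x y * f y) + C) (hD : Integrable D)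
    {M ρ : ℝ} (hM : ∀ x, |D x| ≤ M) (hρ : ∀ x, D x ≠ 0 → ‖x‖ ≤ ρ) :
    ∫ x, u x * D x = c * (∫ y, f y * ∫ x, logKernel x y * D x) + C * ∫ x, D x := by
  have hI := integrable_prod_logKernel hn hf hfc hD hM hρ
  have hI1 : Integrable fun x => D x * ∫ y, logKernel x y * f y := by
    refine hI.integral_prod_left.congr (ae_of_all _ fun x => ?_)
    simp only [integral_const_mul]
  calc ∫ x, u x * D x = ∫ x, (c * (D x * ∫ y, logKernel x y * f y) + C * D x) := by
        congr 1; ext x; rw [hu]; ring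
    _ = c * (∫ x, D x * ∫ y, logKernel x y * f y) + C * ∫ x, D x := by
        rw [integral_add (hI1.const_mul c) (hD.const_mul C), integral_const_mul, integral_const_mul]
    _ = _ := by
        congr 2
        calc ∫ x, D x * ∫ y, logKernel x y * f y
            = ∫ x, ∫ y, D x * (logKernel x y * f y) := by
              congr 1; ext x; rw [integral_const_mul]
          _ = ∫ y, ∫ x, D x * (logKernel x y * f y) := integral_integral_swap hI
          _ = _ := by
              congr 1; ext y; rw [← integral_const_mul]; congr 1; ext x; ring

/-- The part `log ‖y‖` is constant in `x` and integrates to zero against a divergence. At `y = 0`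
the convention `log 0 = 0` makes the kernel vanish identically, hence the exclusion. -/
lemma integral_logKernel_mul_divergence (hn : 2 ≤ n) {W : Euc n → Euc n} (hW : ContDiff ℝ 1 W)
    (hs : HasCompactSupport W) {y : Euc n} (hy : y ≠ 0) :
    ∫ x, logKernel x y * divergence W x = ∫ x, inner ℝ (x - y) (W x) * (‖x - y‖ ^ 2)⁻¹ := by
  have := nontrivial_euc hn
  have hae : ∀ᵐ x : Euc n, x ≠ y := by simp [ae_iff]
  have hDc := continuous_divergence hW
  have hDs := hasCompactSupport_divergence hs
  have hDi := hDc.integrable_of_hasCompactSupport (μ := volume) hDs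
  obtain ⟨M, hM⟩ := hDc.bounded_above_of_compact_support hDs
  have hlog : Integrable fun x => Real.log ‖x - y‖ * divergence W x := by
    have h1 : Integrable fun x => (‖x - y‖ ^ 2 + 1) * |divergence W x| :=
      Continuous.integrable_of_hasCompactSupport (by fun_prop)
        (hDs.norm.mul_left (f := fun x => ‖x - y‖ ^ 2 + 1))
    have h2 := (integrable_mul_norm_sub_inv hn hDi.abs (y := y) (M := M) fun x _ => by
          simpa using hM x).1
    refine (h1.add h2).mono' ((by fun_prop : Measurable fun x : Euc n =>
      Real.log ‖x - y‖).aestronglyMeasurable.mul hDc.aestronglyMeasurable) ?_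
    filter_upwards [hae] with x hx
    have hr : 0 < ‖x - y‖ := norm_pos_iff.2 (sub_ne_zero.2 hx)
    have hu := Real.log_le_sub_one_of_pos hr
    have hl := Real.log_le_sub_one_of_pos (inv_pos.2 hr)
    rw [Real.log_inv] at hl
    have hi := inv_pos.2 hr
    have h3 : |Real.log ‖x - y‖| ≤ ‖x - y‖ ^ 2 + 1 + ‖x - y‖⁻¹ := by
      rw [abs_le]; constructor <;> nlinarith
    have := mul_le_mul_of_nonneg_right h3 (abs_nonneg (divergence W x))
    simp only [Pi.add_apply, norm_mul, Real.norm_eq_abs]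
    linarith
  calc ∫ x, logKernel x y * divergence W x
      = ∫ x, (Real.log ‖y‖ * divergence W x - Real.log ‖x - y‖ * divergence W x) := by
        refine integral_congr_ae ?_
        filter_upwards [hae] with x hx
        rw [logKernel, Real.log_div (norm_ne_zero_iff.2 hy) (norm_ne_zero_iff.2 (sub_ne_zero.2 hx))]
        ring
    _ = _ := by
        rw [integral_sub (hDi.const_mul _) hlog, integral_const_mul, integral_divergence hW hs,
          integral_log_mul_divergence hn hW hs]
        ring

/-! ### Pohozaev identity for compactly supported fields. -/

/-- The kernel obtained by symmetrising `⟪X x, x - y⟫ / |x - y|²`. -/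
noncomputable def symmKernel (X : Euc n → Euc n) (q : Euc n × Euc n) : ℝ :=
  inner ℝ (q.1 - q.2) (X q.1 - X q.2) * (‖q.1 - q.2‖ ^ 2)⁻¹

lemma hasCompactSupport_smul {X : Euc n → Euc n} (hs : HasCompactSupport X) (g : Euc n → ℝ) :
    HasCompactSupport fun x => g x • X x := by
  refine hs.mono fun x hx => ?_
  contrapose! hx
  simp only [Function.mem_support, not_not] at hx ⊢
  rw [hx, smul_zero]

lemma integrable_prod_inner_kernel (hn : 2 ≤ n) {f : Euc n → ℝ} {X : Euc n → Euc n}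
    (hf : Integrable f) (hfc : Continuous f) (hX : Continuous X) (hs : HasCompactSupport X) :
    Integrable (fun q : Euc n × Euc n =>
      f q.1 * f q.2 * (inner ℝ (q.1 - q.2) (X q.1) * (‖q.1 - q.2‖ ^ 2)⁻¹))
      (volume.prod volume) := by
  have hW : Continuous fun x => f x * ‖X x‖ := hfc.mul hX.norm
  have hWs : HasCompactSupport fun x => f x * ‖X x‖ := hs.norm.mul_left
  obtain ⟨M, hM⟩ := hW.bounded_above_of_compact_support hWs
  have h0 := integrable_prod_mul_norm_sub_inv hn hf
    (hW.integrable_of_hasCompactSupport hWs) (M := M) hM measurable_id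
  have hm : Measurable fun q : Euc n × Euc n => inner ℝ (q.1 - q.2) (X q.1) :=
    (measurable_fst.sub measurable_snd).inner (hX.measurable.comp measurable_fst)
  have hm2 : Measurable fun q : Euc n × Euc n => f q.1 * f q.2 :=
    (hfc.measurable.comp measurable_fst).mul (hfc.measurable.comp measurable_snd)
  refine h0.norm.mono' (hm2.mul (hm.mul (by fun_prop))).aestronglyMeasurable
    (ae_of_all _ fun q => ?_)
  simp only [norm_mul, norm_inv, norm_pow, norm_norm, id]
  have h2 := norm_inner_le_norm (𝕜 := ℝ) (q.1 - q.2) (X q.1)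
  rcases eq_or_ne ‖q.1 - q.2‖ 0 with h | h
  · rw [h]; simp
  calc _ ≤ ‖f q.1‖ * ‖f q.2‖ * ((‖q.1 - q.2‖ * ‖X q.1‖) * (‖q.1 - q.2‖ ^ 2)⁻¹) := by gcongr
    _ = _ := by field_simp

/-- The weight `f q.1 * f q.2` is symmetric, so adding the integral with the variables swapped
replaces `X q.1` by `X q.1 - X q.2`. For Lipschitz `X` this cancels the singularity. -/
lemma two_mul_integral_inner_kernel (hn : 2 ≤ n) {f : Euc n → ℝ} {X : Euc n → Euc n}
    (hf : Integrable f) (hfc : Continuous f) (hX : Continuous X) (hs : HasCompactSupport X) :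
    2 * ∫ q : Euc n × Euc n,
        f q.1 * f q.2 * (inner ℝ (q.1 - q.2) (X q.1) * (‖q.1 - q.2‖ ^ 2)⁻¹) ∂(volume.prod volume) =
      ∫ q, f q.1 * f q.2 * symmKernel X q ∂(volume.prod volume) := by
  have hi := integrable_prod_inner_kernel hn hf hfc hX hs
  have hsw := integral_prod_swap (μ := volume) (ν := volume) fun q : Euc n × Euc n =>
    f q.1 * f q.2 * (inner ℝ (q.1 - q.2) (X q.1) * (‖q.1 - q.2‖ ^ 2)⁻¹)
  rw [two_mul]
  nth_rewrite 2 [← hsw]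
  refine (integral_add hi hi.swap).symm.trans ?_
  refine integral_congr_ae (ae_of_all _ fun q => ?_)
  have h1 : q.2 - q.1 = -(q.1 - q.2) := by abel
  simp only [symmKernel, Function.comp_apply, Prod.fst_swap, Prod.snd_swap]
  rw [h1, norm_neg, inner_neg_left, inner_sub_right]; ring

/-- Two integrations by parts: the first differentiates `e^{nu}`, producing `n e^{nu} ∇u`, and the
second moves the derivative off `u`. Then `u` appears undifferentiated and its integral
representation can be inserted directly. -/
lemma integral_exp_mul_divergence {Q u : Euc n → ℝ} (hQ : ContDiff ℝ 1 Q) (hu : ContDiff ℝ 1 u)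
    {X : Euc n → Euc n} (hX : ContDiff ℝ 1 X) (hs : HasCompactSupport X) :
    ∫ x, Real.exp (n * u x) * (Q x * divergence X x + fderiv ℝ Q x (X x)) =
      n * ∫ x, u x * divergence (fun x => (Q x * Real.exp (n * u x)) • X x) x := by
  have hE : ContDiff ℝ 1 fun x => Real.exp (n * u x) := (contDiff_const.mul hu).exp
  have hQX : ContDiff ℝ 1 fun x => Q x • X x := hQ.smul hX
  have hQXs : HasCompactSupport fun x => Q x • X x := hasCompactSupport_smul hs Q
  have h1 := integral_mul_divergence hE hQX hQXs
  have hW : ContDiff ℝ 1 fun x => (Q x * Real.exp (n * u x)) • X x := (hQ.mul hE).smul hX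
  have h2 := integral_mul_divergence hu hW (hasCompactSupport_smul hs _)
  have hud := hu.differentiable one_ne_zero
  rw [h2, ← integral_neg, ← integral_const_mul]
  rw [← integral_neg] at h1
  have h3 : ∀ x, divergence (fun x => Q x • X x) x =
      Q x * divergence X x + fderiv ℝ Q x (X x) := fun x =>
    divergence_smul (hQ.differentiable one_ne_zero x) (hX.differentiable one_ne_zero x)
  simp only [h3] at h1
  rw [h1]
  refine integral_congr_ae (ae_of_all _ fun x => ?_)
  have h4 : HasFDerivAt (fun x => Real.exp (n * u x))
      (Real.exp (n * u x) • ((n : ℝ) • fderiv ℝ u x)) x :=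
    ((hud x).hasFDerivAt.const_mul (n : ℝ)).exp
  simp only [h4.fderiv, map_smul, _root_.smul_apply, smul_eq_mul]; ring

/-- The Pohozaev identity tested against a compactly supported vector field. -/
theorem pohozaev_compactSupport (hn : 2 ≤ n) {Q u : Euc n → ℝ} {c C : ℝ}
    (hQ : ContDiff ℝ 1 Q) (hu : ContDiff ℝ 1 u)
    (hf : Integrable fun x => Q x * Real.exp (n * u x))
    (hrep : ∀ x, u x = c * (∫ y, logKernel x y * (Q y * Real.exp (n * u y))) + C)
    {X : Euc n → Euc n} (hX : ContDiff ℝ 1 X) (hs : HasCompactSupport X) :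
    2 * ∫ x, Real.exp (n * u x) * (Q x * divergence X x + fderiv ℝ Q x (X x)) =
      n * c * ∫ q, (Q q.1 * Real.exp (n * u q.1)) * (Q q.2 * Real.exp (n * u q.2)) *
        symmKernel X q ∂(volume.prod volume) := by
  have := nontrivial_euc hn
  rw [integral_exp_mul_divergence hQ hu hX hs]
  have hfC : ContDiff ℝ 1 fun x => Q x * Real.exp (n * u x) :=
    hQ.mul (contDiff_const.mul hu).exp
  generalize hfdef : (fun x => Q x * Real.exp (n * u x)) = f at hf hfC
  have hfx : ∀ x, Q x * Real.exp (n * u x) = f x := fun x => congrFun hfdef x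
  simp only [hfx] at hrep ⊢
  rw [← two_mul_integral_inner_kernel hn hf hfC.continuous hX.continuous hs]
  have hW : ContDiff ℝ 1 fun x => f x • X x := hfC.smul hX
  have hWs : HasCompactSupport fun x => f x • X x := hasCompactSupport_smul hs f
  have hDc := continuous_divergence hW
  have hDs := hasCompactSupport_divergence hWs
  obtain ⟨M, hM⟩ := hDc.bounded_above_of_compact_support hDs
  obtain ⟨ρ, hρ⟩ := hDs.isCompact.isBounded.subset_closedBall (0 : Euc n)
  have e1 := integral_mul_logPotential hn hf hfC.continuous hrep
    (hDc.integrable_of_hasCompactSupport hDs) (M := M) hM (ρ := ρ) fun x hx => by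
      simpa using hρ (subset_tsupport _ hx)
  rw [integral_divergence hW hWs, mul_zero, add_zero] at e1
  have e2 : ∫ y, f y * ∫ x, logKernel x y * divergence (fun x => f x • X x) x =
      ∫ q : Euc n × Euc n, f q.1 * f q.2 *
        (inner ℝ (q.1 - q.2) (X q.1) * (‖q.1 - q.2‖ ^ 2)⁻¹) ∂(volume.prod volume) := by
    rw [integral_prod_symm _
      (integrable_prod_inner_kernel hn hf hfC.continuous hX.continuous hs)]
    refine integral_congr_ae ?_
    have hae : ∀ᵐ y : Euc n, y ≠ 0 := by simp [ae_iff]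
    filter_upwards [hae] with y hy
    rw [integral_logKernel_mul_divergence hn hW hWs hy, ← integral_const_mul]
    refine integral_congr_ae (ae_of_all _ fun x => ?_)
    simp only [inner_smul_right]; ring
  rw [e1, e2]; ring

/-! ### Cut-off dilation fields and the limiting Pohozaev identity. -/

/-- A smooth bump, equal to `1` on the unit ball and supported in the ball of radius `2`. -/
noncomputable def unitBump (n : ℕ) : ContDiffBump (0 : Euc n) := ⟨1, 2, one_pos, one_lt_two⟩

/-- A smooth cutoff at scale `k + 1` around `p`. -/
noncomputable def cutoff (p : Euc n) (k : ℕ) (x : Euc n) : ℝ :=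
  unitBump n (((k : ℝ) + 1)⁻¹ • (x - p))

/-- The dilation field centred at `p`, cut off at scale `k + 1`. -/
noncomputable def cutoffField (p : Euc n) (k : ℕ) (x : Euc n) : Euc n := cutoff p k x • (x - p)

lemma cutoff_nonneg (p : Euc n) (k : ℕ) (x : Euc n) : 0 ≤ cutoff p k x := (unitBump n).nonneg

lemma cutoff_le_one (p : Euc n) (k : ℕ) (x : Euc n) : cutoff p k x ≤ 1 := (unitBump n).le_one

lemma cutoff_eq_one {p x : Euc n} {k : ℕ} (hx : x ∈ ball p ((k : ℝ) + 1)) : cutoff p k x = 1 := by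
  refine (unitBump n).one_of_mem_closedBall ?_
  have hk : (0 : ℝ) < (k : ℝ) + 1 := by positivity
  have h : ‖x - p‖ < (k : ℝ) + 1 := by simpa [dist_eq_norm] using hx
  have h1 : (unitBump n).rIn = 1 := rfl
  rw [mem_closedBall_zero_iff, norm_smul, norm_inv, Real.norm_of_nonneg hk.le, h1,
    inv_mul_le_iff₀ hk]
  linarith

lemma eventually_mem_ball (p x : Euc n) : ∀ᶠ k : ℕ in atTop, x ∈ ball p ((k : ℝ) + 1) := by
  obtain ⟨N, hN⟩ := exists_nat_gt (dist x p)
  filter_upwards [eventually_ge_atTop N] with k hk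
  have : (N : ℝ) ≤ k := by exact_mod_cast hk
  rw [mem_ball]; linarith

lemma contDiff_cutoff (p : Euc n) (k : ℕ) : ContDiff ℝ 1 (cutoff p k) :=
  ((unitBump n).contDiff (n := 1)).comp
    ((contDiff_id.sub contDiff_const).const_smul ((k : ℝ) + 1)⁻¹)

lemma contDiff_cutoffField (p : Euc n) (k : ℕ) : ContDiff ℝ 1 (cutoffField p k) :=
  (contDiff_cutoff p k).smul (contDiff_id.sub contDiff_const)

lemma hasCompactSupport_cutoff (p : Euc n) (k : ℕ) : HasCompactSupport (cutoff p k) := by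
  refine HasCompactSupport.intro (isCompact_closedBall p (2 * ((k : ℝ) + 1))) fun x hx => ?_
  refine (unitBump n).zero_of_le_dist ?_
  have hk : (0 : ℝ) < (k : ℝ) + 1 := by positivity
  have h : 2 * ((k : ℝ) + 1) < ‖x - p‖ := by simpa [dist_eq_norm] using hx
  have h1 : (unitBump n).rOut = 2 := rfl
  rw [dist_zero_right, norm_smul, norm_inv, Real.norm_of_nonneg hk.le, h1, le_inv_mul_iff₀ hk]
  linarith

lemma hasCompactSupport_cutoffField (p : Euc n) (k : ℕ) :
    HasCompactSupport (cutoffField p k) := by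
  refine (hasCompactSupport_cutoff p k).mono fun x hx => ?_
  contrapose! hx
  simp only [Function.mem_support, not_not] at hx ⊢
  rw [cutoffField, hx, zero_smul]

/-- The fields are the rescalings `r X ((z - p) / r)` of one compactly supported field, and this
rescaling preserves Lipschitz constants. The common constant bounds both the divergences and the
symmetrised kernels uniformly in `k`. -/
lemma exists_lipschitz_cutoffField (p : Euc n) :
    ∃ L : NNReal, ∀ k, LipschitzWith L (cutoffField p k) := by
  set X : Euc n → Euc n := fun v => unitBump n v • v with hX
  have hXc : ContDiff ℝ 1 X := (unitBump n).contDiff.smul contDiff_id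
  have hXs : HasCompactSupport X := by
    refine (unitBump n).hasCompactSupport.mono fun x hx => ?_
    contrapose! hx
    simp only [Function.mem_support, not_not] at hx ⊢
    simp only [hX, hx, zero_smul]
  obtain ⟨L, hL⟩ := hXc.lipschitzWith_of_hasCompactSupport hXs one_ne_zero
  refine ⟨L, fun k => LipschitzWith.of_dist_le_mul fun x y => ?_⟩
  have hk : (0 : ℝ) < (k : ℝ) + 1 := by positivity
  have hs : ∀ z, cutoffField p k z = ((k : ℝ) + 1) • X (((k : ℝ) + 1)⁻¹ • (z - p)) := by
    intro z
    simp only [hX, cutoffField, cutoff, smul_smul]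
    congr 1; field_simp
  have h := hL.dist_le_mul (((k : ℝ) + 1)⁻¹ • (x - p)) (((k : ℝ) + 1)⁻¹ • (y - p))
  rw [dist_smul₀, dist_sub_right, norm_inv, Real.norm_of_nonneg hk.le] at h
  rw [hs, hs, dist_smul₀, Real.norm_of_nonneg hk.le]
  calc _ ≤ ((k : ℝ) + 1) * (L * (((k : ℝ) + 1)⁻¹ * dist x y)) := by gcongr
    _ = L * dist x y := by field_simp

lemma abs_divergence_le {X : Euc n → Euc n} {L : NNReal} (hX : LipschitzWith L X) (x : Euc n) :
    |divergence X x| ≤ n * L := by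
  calc |divergence X x| ≤ ∑ i : Fin n, |(fderiv ℝ X x (EuclideanSpace.single i 1)) i| :=
        Finset.abs_sum_le_sum_abs _ _
    _ ≤ ∑ _i : Fin n, (L : ℝ) := by
        refine Finset.sum_le_sum fun i _ => ?_
        have h1 := PiLp.norm_apply_le (fderiv ℝ X x (EuclideanSpace.single i 1)) i
        have h2 := (fderiv ℝ X x).le_opNorm (EuclideanSpace.single i 1)
        have h3 := norm_fderiv_le_of_lipschitz ℝ hX (x₀ := x)
        rw [PiLp.norm_single, norm_one, mul_one] at h2
        exact h1.trans (h2.trans h3)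
    _ = n * L := by simp

lemma divergence_cutoffField {p x : Euc n} {k : ℕ} (hx : x ∈ ball p ((k : ℝ) + 1)) :
    divergence (cutoffField p k) x = n := by
  have h : cutoffField p k =ᶠ[𝓝 x] fun z => z - p := by
    filter_upwards [isOpen_ball.mem_nhds hx] with z hz
    rw [cutoffField, cutoff_eq_one hz, one_smul]
  have h2 : HasFDerivAt (fun z : Euc n => z - p) (ContinuousLinearMap.id ℝ _) x :=
    (hasFDerivAt_id x).sub_const p
  simp [divergence, h.fderiv_eq, h2.fderiv]

lemma measurable_symmKernel {X : Euc n → Euc n} (hX : Continuous X) :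
    Measurable (symmKernel X) := by
  unfold symmKernel
  refine Measurable.mul (Measurable.inner (by fun_prop) ?_) (by fun_prop)
  exact (hX.measurable.comp measurable_fst).sub (hX.measurable.comp measurable_snd)

lemma abs_symmKernel_le {X : Euc n → Euc n} {L : NNReal} (hX : LipschitzWith L X)
    (q : Euc n × Euc n) : |symmKernel X q| ≤ L := by
  rcases eq_or_ne ‖q.1 - q.2‖ 0 with h | h
  · simp [symmKernel, h]
  have h1 := abs_real_inner_le_norm (q.1 - q.2) (X q.1 - X q.2)
  have h2 := hX.dist_le_mul q.1 q.2
  rw [dist_eq_norm, dist_eq_norm] at h2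
  rw [symmKernel, abs_mul, abs_inv, abs_of_nonneg (sq_nonneg ‖q.1 - q.2‖)]
  calc _ ≤ ‖q.1 - q.2‖ * (L * ‖q.1 - q.2‖) * (‖q.1 - q.2‖ ^ 2)⁻¹ := by
        refine mul_le_mul_of_nonneg_right (h1.trans ?_) (by positivity)
        exact mul_le_mul_of_nonneg_left h2 (norm_nonneg _)
    _ = L := by field_simp

lemma symmKernel_cutoffField {p : Euc n} {k : ℕ} {q : Euc n × Euc n} (hq : q.1 ≠ q.2)
    (h1 : q.1 ∈ ball p ((k : ℝ) + 1)) (h2 : q.2 ∈ ball p ((k : ℝ) + 1)) :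
    symmKernel (cutoffField p k) q = 1 := by
  have h : ‖q.1 - q.2‖ ≠ 0 := norm_ne_zero_iff.2 (sub_ne_zero.2 hq)
  rw [symmKernel, cutoffField, cutoffField, cutoff_eq_one h1, cutoff_eq_one h2, one_smul, one_smul,
    sub_sub_sub_cancel_right, real_inner_self_eq_norm_sq]
  exact mul_inv_cancel₀ (by positivity)

lemma ae_fst_ne_snd (hn : 2 ≤ n) :
    ∀ᵐ q : Euc n × Euc n ∂(volume.prod volume), q.1 ≠ q.2 := by
  have := nontrivial_euc hn
  refine (Measure.ae_prod_iff_ae_ae ?_).2 (ae_of_all _ fun x => ?_)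
  · exact (measurableSet_eq_fun measurable_fst measurable_snd).compl
  · have : ∀ᵐ y : Euc n, y ≠ x := by simp [ae_iff]
    filter_upwards [this] with y hy using hy.symm

/-- The Pohozaev identity for normal solutions, with the curvature term as a limit. -/
theorem tendsto_pohozaev (hn : 2 ≤ n) {Q u : Euc n → ℝ} {c C : ℝ}
    (hQ : ContDiff ℝ 1 Q) (hu : ContDiff ℝ 1 u)
    (hf : Integrable fun x => Q x * Real.exp (n * u x))
    (hrep : ∀ x, u x = c * (∫ y, logKernel x y * (Q y * Real.exp (n * u y))) + C) (p : Euc n) :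
    Tendsto (fun k => 2 * ∫ x, Real.exp (n * u x) * (cutoff p k x * fderiv ℝ Q x (x - p))) atTop
      (𝓝 (n * c * (∫ x, Q x * Real.exp (n * u x)) ^ 2 -
        2 * (n * ∫ x, Q x * Real.exp (n * u x)))) := by
  have key := fun k => pohozaev_compactSupport hn hQ hu hf hrep (contDiff_cutoffField p k)
    (hasCompactSupport_cutoffField p k)
  have hexp : Continuous fun x => Real.exp (n * u x) :=
    Real.continuous_exp.comp (continuous_const.mul hu.continuous)
  have hDQ : Continuous fun x => fderiv ℝ Q x (x - p) :=
    (hQ.continuous_fderiv one_ne_zero).clm_apply (continuous_id.sub continuous_const)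
  have hi1 : ∀ k, Integrable fun x =>
      Real.exp (n * u x) * (cutoff p k x * fderiv ℝ Q x (x - p)) := fun k =>
    (hexp.mul ((contDiff_cutoff p k).continuous.mul hDQ)).integrable_of_hasCompactSupport
      ((hasCompactSupport_cutoff p k).mul_right.mul_left)
  have hi2 : ∀ k, Integrable fun x =>
      Q x * Real.exp (n * u x) * divergence (cutoffField p k) x := fun k =>
    ((hQ.continuous.mul hexp).mul (continuous_divergence
      (contDiff_cutoffField p k))).integrable_of_hasCompactSupport
      ((hasCompactSupport_divergence (hasCompactSupport_cutoffField p k)).mul_left)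
  -- Solve for the curvature term, the only one without an integrable majorant at hand; the other
  -- two converge by domination.
  have hsplit : ∀ k, 2 * ∫ x, Real.exp (n * u x) * (cutoff p k x * fderiv ℝ Q x (x - p)) =
      n * c * (∫ q, (Q q.1 * Real.exp (n * u q.1)) * (Q q.2 * Real.exp (n * u q.2)) *
        symmKernel (cutoffField p k) q ∂(volume.prod volume)) -
      2 * ∫ x, Q x * Real.exp (n * u x) * divergence (cutoffField p k) x := by
    intro k
    rw [← key k, ← mul_sub, ← integral_sub _ (hi2 k)]
    · congr 2; ext x
      simp only [cutoffField, map_smul, smul_eq_mul]; ring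
    · refine ((hi2 k).add (hi1 k)).congr (ae_of_all _ fun x => ?_)
      simp only [Pi.add_apply, cutoffField, map_smul, smul_eq_mul]; ring
  simp only [hsplit]
  obtain ⟨L, hL⟩ := exists_lipschitz_cutoffField p
  refine Tendsto.sub (Tendsto.const_mul _ ?_) (Tendsto.const_mul _ ?_)
  · have hff := hf.mul_prod hf
    rw [sq, ← integral_prod_mul]
    refine tendsto_integral_of_dominated_convergence
      (fun q => ‖(Q q.1 * Real.exp (n * u q.1)) * (Q q.2 * Real.exp (n * u q.2))‖ * L)
      (fun k => hff.aestronglyMeasurable.mul (measurable_symmKernel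
        (contDiff_cutoffField p k).continuous).aestronglyMeasurable) (hff.norm.mul_const _)
      (fun k => ae_of_all _ fun q => ?_) ?_
    · rw [norm_mul]
      exact mul_le_mul_of_nonneg_left (abs_symmKernel_le (hL k) q) (norm_nonneg _)
    · filter_upwards [ae_fst_ne_snd hn] with q hq
      refine tendsto_const_nhds.congr' ?_
      filter_upwards [eventually_mem_ball p q.1, eventually_mem_ball p q.2] with k h1 h2
      rw [symmKernel_cutoffField hq h1 h2, mul_one]
  · rw [mul_comm, ← integral_mul_const]
    refine tendsto_integral_of_dominated_convergence
      (fun x => ‖Q x * Real.exp (n * u x)‖ * (n * L)) (fun k => (hi2 k).aestronglyMeasurable)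
      (hf.norm.mul_const _) (fun k => ae_of_all _ fun x => ?_) (ae_of_all _ fun x => ?_)
    · rw [norm_mul]
      exact mul_le_mul_of_nonneg_left (abs_divergence_le (hL k) x) (norm_nonneg _)
    · refine tendsto_const_nhds.congr' ?_
      filter_upwards [eventually_mem_ball p x] with k h1
      rw [divergence_cutoffField h1]

/-- The Pohozaev inequality for a curvature whose dilation derivative at `p` is at least `ℓ`. -/
theorem pohozaev_le (hn : 2 ≤ n) {Q u ℓ : Euc n → ℝ} {c C : ℝ}
    (hQ : ContDiff ℝ 1 Q) (hu : ContDiff ℝ 1 u)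
    (hf : Integrable fun x => Q x * Real.exp (n * u x))
    (hrep : ∀ x, u x = c * (∫ y, logKernel x y * (Q y * Real.exp (n * u y))) + C) {p : Euc n}
    (hℓ : ∀ x, ℓ x ≤ fderiv ℝ Q x (x - p)) (hi : Integrable fun x => ℓ x * Real.exp (n * u x)) :
    2 * ∫ x, ℓ x * Real.exp (n * u x) ≤ n * c * (∫ x, Q x * Real.exp (n * u x)) ^ 2 -
        2 * (n * ∫ x, Q x * Real.exp (n * u x)) := by
  have hexp : Continuous fun x => Real.exp (n * u x) :=
    Real.continuous_exp.comp (continuous_const.mul hu.continuous)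
  have hDQ : Continuous fun x => fderiv ℝ Q x (x - p) :=
    (hQ.continuous_fderiv one_ne_zero).clm_apply (continuous_id.sub continuous_const)
  have hmeas : ∀ k, AEStronglyMeasurable (fun x => cutoff p k x * (ℓ x * Real.exp (n * u x)))
      volume := fun k =>
    (contDiff_cutoff p k).continuous.aestronglyMeasurable.mul hi.aestronglyMeasurable
  have hbd : ∀ k x, ‖cutoff p k x * (ℓ x * Real.exp (n * u x))‖ ≤ ‖ℓ x * Real.exp (n * u x)‖ := by
    intro k x
    rw [norm_mul, Real.norm_of_nonneg (cutoff_nonneg p k x)]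
    exact mul_le_of_le_one_left (norm_nonneg _) (cutoff_le_one p k x)
  have ht : Tendsto (fun k => 2 * ∫ x, cutoff p k x * (ℓ x * Real.exp (n * u x))) atTop
      (𝓝 (2 * ∫ x, ℓ x * Real.exp (n * u x))) := by
    refine (tendsto_integral_of_dominated_convergence _ hmeas hi.norm
      (fun k => ae_of_all _ (hbd k)) (ae_of_all _ fun x => ?_)).const_mul 2
    refine tendsto_const_nhds.congr' ?_
    filter_upwards [eventually_mem_ball p x] with k h1
    rw [cutoff_eq_one h1, one_mul]
  -- The cutoffs are nonnegative, so the pointwise bound survives at each `k` and passes to the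
  -- limit.
  refine le_of_tendsto_of_tendsto' ht (tendsto_pohozaev hn hQ hu hf hrep p) fun k => ?_
  refine mul_le_mul_of_nonneg_left (integral_mono (hi.norm.mono' (hmeas k) (ae_of_all _ (hbd k)))
    ?_ fun x => ?_) two_pos.le
  · exact (hexp.mul ((contDiff_cutoff p k).continuous.mul hDQ)).integrable_of_hasCompactSupport
      ((hasCompactSupport_cutoff p k).mul_right.mul_left)
  · have h1 := mul_le_mul_of_nonneg_left (hℓ x)
      (mul_nonneg (cutoff_nonneg p k x) (Real.exp_pos (n * u x)).le)
    simp only; linarith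

/-! ### Averages over dilated balls and the decay of `u`. -/

lemma logKernel_smul {R : ℝ} (hR : 0 < R) (z y : Euc n) :
    logKernel (R • z) y = logKernel z (R⁻¹ • y) := by
  have h : z - R⁻¹ • y = R⁻¹ • (R • z - y) := by
    rw [smul_sub, smul_smul, inv_mul_cancel₀ hR.ne', one_smul]
  rw [logKernel, logKernel, h, norm_smul, norm_smul, mul_div_mul_left]
  exact norm_ne_zero_iff.2 (inv_ne_zero hR.ne')

lemma setIntegral_norm_sub_inv (hn : 2 ≤ n) {B : Set (Euc n)} (hB : MeasurableSet B)
    (hfin : volume B ≠ ⊤) (w : Euc n) :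
    IntegrableOn (fun z => ‖z - w‖⁻¹) B ∧
      ∫ z in B, ‖z - w‖⁻¹ ≤ ballNewton n + volume.real B := by
  have hg : Integrable (B.indicator fun _ : Euc n => (1 : ℝ)) :=
    (integrable_indicator_iff hB).2 (integrableOn_const hfin)
  have hM : ∀ x ∈ ball w 1, |B.indicator (fun _ : Euc n => (1 : ℝ)) x| ≤ 1 := fun x _ => by
    by_cases hx : x ∈ B <;> simp [hx]
  have h := integrable_mul_norm_sub_inv hn hg hM
  have e : (fun x => B.indicator (fun _ : Euc n => (1 : ℝ)) x * ‖x - w‖⁻¹) =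
      B.indicator fun z => ‖z - w‖⁻¹ := by
    ext x; by_cases hx : x ∈ B <;> simp [hx]
  have e2 : (fun x => |B.indicator (fun _ : Euc n => (1 : ℝ)) x|) =
      B.indicator fun _ : Euc n => (1 : ℝ) := by
    ext x; by_cases hx : x ∈ B <;> simp [hx]
  have e3 : (fun x => |B.indicator (fun _ : Euc n => (1 : ℝ)) x| * ‖x - w‖⁻¹) =
      B.indicator fun z => ‖z - w‖⁻¹ := by
    ext x; by_cases hx : x ∈ B <;> simp [hx]
  rw [e, e2, e3, integrable_indicator_iff hB, integral_indicator hB, integral_indicator hB] at h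
  simpa using h

lemma norm_le_of_mem_closedBall_abs {q z : Euc n} {ρ : ℝ} (hz : z ∈ closedBall q ρ) :
    ‖z‖ ≤ ‖q‖ + |ρ| := by
  have h1 : ‖z - q‖ ≤ ρ := by simpa [dist_eq_norm] using hz
  have h2 := norm_le_norm_add_norm_sub q z
  rw [norm_sub_rev] at h2
  have := le_abs_self ρ
  linarith

lemma setIntegral_logKernel_bound (hn : 2 ≤ n) {B : Set (Euc n)} (hB : MeasurableSet B)
    (hfin : volume B ≠ ⊤) {S : ℝ} (hS0 : 0 ≤ S) (hS : ∀ z ∈ B, ‖z‖ ≤ S) (w : Euc n) :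
    IntegrableOn (fun z => logKernel z w) B ∧
      |∫ z in B, logKernel z w| ≤
        S * (‖w‖⁻¹ * volume.real B + (ballNewton n + volume.real B)) := by
  have hi := setIntegral_norm_sub_inv hn hB hfin w
  have hc : IntegrableOn (fun _ : Euc n => ‖w‖⁻¹) B := integrableOn_const hfin
  have hki : IntegrableOn (fun z => S * (‖w‖⁻¹ + ‖z - w‖⁻¹)) B := (Integrable.add hc hi.1).const_mul S
  have hle : ∀ z ∈ B, ‖logKernel z w‖ ≤ S * (‖w‖⁻¹ + ‖z - w‖⁻¹) := fun z hz =>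
    (abs_logKernel_le z w).trans (mul_le_mul_of_nonneg_right (hS z hz) (by positivity))
  have hm : Measurable fun z : Euc n => logKernel z w := by
    unfold logKernel; fun_prop
  have hae : ∀ᵐ z ∂volume.restrict B, ‖logKernel z w‖ ≤ S * (‖w‖⁻¹ + ‖z - w‖⁻¹) :=
    (ae_restrict_iff' hB).2 (ae_of_all _ hle)
  refine ⟨Integrable.mono' hki hm.aestronglyMeasurable hae, ?_⟩
  have h1 := norm_integral_le_of_norm_le hki hae
  rw [integral_const_mul, integral_add hc hi.1, setIntegral_const, smul_eq_mul,
    Real.norm_eq_abs] at h1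
  refine h1.trans (mul_le_mul_of_nonneg_left ?_ hS0)
  rw [mul_comm]
  exact add_le_add_right hi.2 _

lemma setIntegral_logKernel_sub_bound (hn : 2 ≤ n) {B : Set (Euc n)} (hB : MeasurableSet B)
    (hfin : volume B ≠ ⊤) {S : ℝ} (hS0 : 0 ≤ S) (hS : ∀ z ∈ B, ‖z‖ ≤ S) {w : Euc n} (hw0 : w ≠ 0) :
    |(∫ z in B, logKernel z w) - volume.real B * Real.log ‖w‖| ≤
      (S + ‖w‖) * volume.real B + (ballNewton n + volume.real B) := by
  have := nontrivial_euc hn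
  have hae : ∀ᵐ z : Euc n, z ≠ w := by simp [ae_iff]
  have hi := setIntegral_norm_sub_inv hn hB hfin w
  have hc : ∀ a : ℝ, IntegrableOn (fun _ : Euc n => a) B := fun a => integrableOn_const hfin
  have hk := (setIntegral_logKernel_bound hn hB hfin hS0 hS w).1
  have e1 : (∫ z in B, logKernel z w) - volume.real B * Real.log ‖w‖ =
      ∫ z in B, (logKernel z w - Real.log ‖w‖) := by
    rw [integral_sub hk (hc _), setIntegral_const, smul_eq_mul]
  have hdi : IntegrableOn (fun z => (S + ‖w‖) + ‖z - w‖⁻¹) B := Integrable.add (hc _) hi.1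
  have hae2 : ∀ᵐ z ∂volume.restrict B,
      ‖logKernel z w - Real.log ‖w‖‖ ≤ (S + ‖w‖) + ‖z - w‖⁻¹ := by
    rw [ae_restrict_iff' hB]
    filter_upwards [hae] with z hz hzB
    have hr : 0 < ‖z - w‖ := norm_pos_iff.2 (sub_ne_zero.2 hz)
    rw [logKernel, Real.log_div (norm_ne_zero_iff.2 hw0) hr.ne', sub_sub_cancel_left, norm_neg,
      Real.norm_eq_abs, abs_le]
    have h1 := Real.log_le_sub_one_of_pos hr
    have h2 := Real.log_le_sub_one_of_pos (inv_pos.2 hr)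
    rw [Real.log_inv] at h2
    have h3 := norm_sub_le z w
    have h4 := hS z hzB
    have h5 := inv_pos.2 hr
    constructor <;> linarith
  have h1 := norm_integral_le_of_norm_le hdi hae2
  rw [integral_add (hc _) hi.1, setIntegral_const, smul_eq_mul, Real.norm_eq_abs] at h1
  rw [e1]
  linarith [hi.2]

/-- Two regimes: the integral over the ball is bounded for `‖w‖ ≥ 1` and equals `volume * log ‖w‖`
up to a bounded error for `‖w‖ ≤ 1`. With `w = R⁻¹ • y` the second regime produces the `-log R`. -/
lemma exists_abs_setIntegral_logKernel_le (hn : 2 ≤ n) (q : Euc n) (ρ : ℝ) :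
    ∃ K : ℝ, 0 ≤ K ∧
      (∀ w : Euc n, 1 ≤ ‖w‖ → |∫ z in closedBall q ρ, logKernel z w| ≤ K) ∧
      ∀ w : Euc n, w ≠ 0 → ‖w‖ ≤ 1 →
        |(∫ z in closedBall q ρ, logKernel z w) - volume.real (closedBall q ρ) * Real.log ‖w‖| ≤
          K := by
  have hfin : volume (closedBall q ρ) ≠ ⊤ := measure_closedBall_lt_top.ne
  have hS0 : 0 ≤ ‖q‖ + |ρ| := by positivity
  have hb1 := setIntegral_logKernel_bound hn measurableSet_closedBall hfin hS0
    fun z hz => norm_le_of_mem_closedBall_abs hz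
  have hb2 := fun w hw => setIntegral_logKernel_sub_bound hn (w := w) measurableSet_closedBall hfin
    hS0 (fun z hz => norm_le_of_mem_closedBall_abs hz) hw
  have hv0 : 0 ≤ volume.real (closedBall q ρ) := measureReal_nonneg
  generalize volume.real (closedBall q ρ) = v at *
  generalize ‖q‖ + |ρ| = S at *
  have hN := ballNewton_nonneg (n := n)
  refine ⟨S * (v + (ballNewton n + v)) + ((S + 1) * v + (ballNewton n + v)),
    by positivity, fun w hw => ?_, fun w hw0 hw => ?_⟩
  · refine (hb1 w).2.trans ?_
    have h2 : ‖w‖⁻¹ ≤ 1 := inv_le_one_of_one_le₀ hw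
    have h3 : ‖w‖⁻¹ * v ≤ 1 * v := by gcongr
    have h4 : S * (‖w‖⁻¹ * v + (ballNewton n + v)) ≤ S * (v + (ballNewton n + v)) := by
      refine mul_le_mul_of_nonneg_left ?_ hS0
      linarith
    have h5 : 0 ≤ (S + 1) * v + (ballNewton n + v) := by positivity
    linarith
  · refine (hb2 w hw0).trans ?_
    have h3 : (S + ‖w‖) * v ≤ (S + 1) * v := by gcongr
    have h5 : 0 ≤ S * (v + (ballNewton n + v)) := by positivity
    linarith

lemma setIntegral_comp_smul_logPotential (hn : 2 ≤ n) {f u : Euc n → ℝ} {c C : ℝ}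
    (hf : Integrable f) (hfc : Continuous f)
    (hu : ∀ x, u x = c * (∫ y, logKernel x y * f y) + C) (q : Euc n) (ρ : ℝ) {R : ℝ} (hR : 0 < R) :
    ∫ z in closedBall q ρ, u (R • z) =
      c * (∫ y, f y * ∫ z in closedBall q ρ, logKernel z (R⁻¹ • y)) +
        C * volume.real (closedBall q ρ) := by
  set B := closedBall q ρ with hBdef
  have hB : MeasurableSet B := measurableSet_closedBall
  set b : Euc n → ℝ := B.indicator fun _ => 1 with hb
  have hbi : Integrable b :=
    (integrable_indicator_iff hB).2 (integrableOn_const measure_closedBall_lt_top.ne)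
  have hmul : ∀ g : Euc n → ℝ, ∫ z, g z * b z = ∫ z in B, g z := fun g => by
    rw [← integral_indicator hB]
    congr 1; ext z
    by_cases hz : z ∈ B <;> simp [hb, hz]
  have hRn : (0 : ℝ) < R ^ n := by positivity
  have hscale : ∀ h : Euc n → ℝ, R ^ n * ∫ w, h (R • w) = ∫ y, h y := fun h => by
    rw [Measure.integral_comp_smul_of_nonneg _ _ _ (hR := hR.le), finrank_euclideanSpace_fin,
      smul_eq_mul, mul_inv_cancel_left₀ hRn.ne']
  -- The dilate of `u` is again a logarithmic potential, with the rescaled density and the same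
  -- constants.
  have hv : ∀ z, u (R • z) = c * (∫ w, logKernel z w * (R ^ n * f (R • w))) + C := fun z => by
    rw [hu, ← hscale, ← integral_const_mul]
    congr 3; ext w
    rw [logKernel_smul hR, smul_smul, inv_mul_cancel₀ hR.ne', one_smul]; ring
  have key := integral_mul_logPotential hn (u := fun z => u (R • z))
    ((hf.comp_smul hR.ne').const_mul (R ^ n))
    (continuous_const.mul (hfc.comp (continuous_const_smul R))) hv hbi (M := 1) (ρ := ‖q‖ + |ρ|)
    (fun x => by by_cases hx : x ∈ B <;> simp [hb, hx]) (fun z hz =>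
      norm_le_of_mem_closedBall_abs (by by_contra h; exact hz (by simp [hb, hBdef, h])))
  simp only [hmul] at key
  rw [key]
  congr 2
  · rw [← hscale fun y => f y * ∫ z in B, logKernel z (R⁻¹ • y), ← integral_const_mul]
    congr 1; ext w
    rw [smul_smul, inv_mul_cancel₀ hR.ne', one_smul]; ring
  · rw [hb, integral_indicator hB, setIntegral_const]; simp

/-- The average of a normal solution over large dilated balls is `-(c ∫ f) log R + o(log R)`. -/
lemma tendsto_average_div_log (hn : 2 ≤ n) {f u : Euc n → ℝ} {c C : ℝ}
    (hf : Integrable f) (hfc : Continuous f)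
    (hu : ∀ x, u x = c * (∫ y, logKernel x y * f y) + C) (q : Euc n) (ρ : ℝ) :
    Tendsto (fun R : ℝ => (∫ z in closedBall q ρ, u (R • z)) / Real.log R) atTop
      (𝓝 (-(volume.real (closedBall q ρ) * (c * ∫ y, f y)))) := by
  have := nontrivial_euc hn
  have hae : ∀ᵐ y : Euc n, y ≠ 0 := by simp [ae_iff]
  obtain ⟨K, hK0, hK1, hK2⟩ := exists_abs_setIntegral_logKernel_le hn q ρ
  set B := closedBall q ρ with hBdef
  set v := volume.real B with hv
  have hv0 : 0 ≤ v := measureReal_nonneg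
  set G : Euc n → ℝ := fun w => ∫ z in B, logKernel z w with hG
  have hGm : StronglyMeasurable G :=
    (measurable_logKernel.comp measurable_swap).stronglyMeasurable.integral_prod_right'
  have hlogy : ∀ R : ℝ, 0 < R → ∀ y : Euc n, y ≠ 0 →
      Real.log ‖R⁻¹ • y‖ = Real.log ‖y‖ - Real.log R := fun R hR y hy => by
    rw [norm_smul, norm_inv, Real.norm_of_nonneg hR.le,
      Real.log_mul (inv_ne_zero hR.ne') (norm_ne_zero_iff.2 hy), Real.log_inv]
    ring
  have hnR : ∀ R : ℝ, 0 < R → ∀ y : Euc n, ‖R⁻¹ • y‖ = ‖y‖ / R := fun R hR y => by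
    rw [norm_smul, norm_inv, Real.norm_of_nonneg hR.le]; field_simp
  have hmain : Tendsto (fun R : ℝ => ∫ y, f y * (G (R⁻¹ • y) / Real.log R)) atTop
      (𝓝 (∫ y, f y * (-v))) := by
    refine tendsto_integral_filter_of_dominated_convergence
      (fun y => ‖f y‖ * (K + v) + ‖f y * ‖y‖⁻¹‖ * v) ?_ ?_ ?_ ?_
    · refine Eventually.of_forall fun R => ?_
      exact hf.aestronglyMeasurable.mul ((hGm.comp_measurable
        (measurable_const_smul (R⁻¹ : ℝ))).measurable.div_const _).aestronglyMeasurable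
    -- For `R ≥ e` one has `log R ≥ 1`, so division by `log R` does not enlarge the bounded terms.
    · filter_upwards [eventually_ge_atTop (Real.exp 1)] with R hR
      have hR0 : 0 < R := (Real.exp_pos 1).trans_le hR
      have hlog : 1 ≤ Real.log R := (Real.le_log_iff_exp_le hR0).2 hR
      filter_upwards [hae] with y hy
      have hy' : 0 < ‖y‖ := norm_pos_iff.2 hy
      have hi : 0 < ‖y‖⁻¹ := inv_pos.2 hy'
      -- Near the origin `-log ‖y‖` is unbounded; it is absorbed by `‖y‖⁻¹`, against which `f` is
      -- integrable.
      have hly : -Real.log ‖y‖ ≤ ‖y‖⁻¹ := by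
        have := Real.log_le_sub_one_of_pos hi
        rw [Real.log_inv] at this; linarith
      have hGb : |G (R⁻¹ • y)| ≤ K + v * (Real.log R + ‖y‖⁻¹) := by
        rcases le_total R ‖y‖ with h | h
        · have := hK1 (R⁻¹ • y) (by rw [hnR R hR0, le_div_iff₀ hR0]; linarith)
          have h2 : 0 ≤ v * (Real.log R + ‖y‖⁻¹) := by positivity
          exact this.trans (by linarith)
        · have h1 := hK2 (R⁻¹ • y) (smul_ne_zero (inv_ne_zero hR0.ne') hy)
            (by rw [hnR R hR0, div_le_one hR0]; exact h)
          rw [hlogy R hR0 y hy] at h1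
          have h3 : Real.log ‖y‖ ≤ Real.log R := Real.log_le_log hy' h
          have h4 := abs_sub_abs_le_abs_sub (G (R⁻¹ • y)) (v * (Real.log ‖y‖ - Real.log R))
          have h5 : |v * (Real.log ‖y‖ - Real.log R)| ≤ v * (Real.log R + ‖y‖⁻¹) := by
            rw [abs_mul, abs_of_nonneg hv0]
            refine mul_le_mul_of_nonneg_left ?_ hv0
            rw [abs_of_nonpos (by linarith)]; linarith
          have h6 := h4.trans h1
          linarith
      have hfin : |G (R⁻¹ • y) / Real.log R| ≤ (K + v) + ‖y‖⁻¹ * v := by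
        rw [abs_div, abs_of_pos (by linarith : 0 < Real.log R), div_le_iff₀ (by linarith)]
        refine hGb.trans ?_
        have h1 : 0 ≤ K * (Real.log R - 1) := mul_nonneg hK0 (by linarith)
        have h2 : 0 ≤ v * ‖y‖⁻¹ * (Real.log R - 1) := mul_nonneg (by positivity) (by linarith)
        nlinarith
      have := mul_le_mul_of_nonneg_left hfin (norm_nonneg (f y))
      rw [norm_mul, norm_mul, norm_inv, norm_norm, Real.norm_eq_abs (G _ / _)]
      linarith
    · exact (hf.norm.mul_const _).add
        ((integrable_mul_norm_inv_of_continuous hn hf hfc).norm.mul_const _)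
    · filter_upwards [hae] with y hy
      refine Tendsto.const_mul _ ?_
      have hlt := Real.tendsto_log_atTop
      have t1 : Tendsto (fun R : ℝ => (K + v * |Real.log ‖y‖|) / Real.log R) atTop (𝓝 0) :=
        tendsto_const_nhds.div_atTop hlt
      rw [tendsto_iff_norm_sub_tendsto_zero]
      refine squeeze_zero' (Eventually.of_forall fun _ => norm_nonneg _) ?_ t1
      filter_upwards [eventually_ge_atTop ‖y‖, eventually_gt_atTop 1] with R hRy hR1
      have hR0 : 0 < R := by linarith
      have hl : 0 < Real.log R := Real.log_pos hR1
      have h1 := hK2 (R⁻¹ • y) (smul_ne_zero (inv_ne_zero hR0.ne') hy)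
            (by rw [hnR R hR0, div_le_one hR0]; exact hRy)
      rw [hlogy R hR0 y hy] at h1
      have e : G (R⁻¹ • y) / Real.log R - -v =
          ((G (R⁻¹ • y) - v * (Real.log ‖y‖ - Real.log R)) + v * Real.log ‖y‖) / Real.log R := by
        field_simp; ring
      rw [e, norm_div, Real.norm_of_nonneg hl.le]
      refine div_le_div_of_nonneg_right ((norm_add_le _ _).trans (add_le_add h1 ?_)) hl.le
      rw [Real.norm_eq_abs, abs_mul, abs_of_nonneg hv0]
  have h2 : Tendsto (fun R : ℝ => C * v / Real.log R) atTop (𝓝 0) :=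
    tendsto_const_nhds.div_atTop Real.tendsto_log_atTop
  have h3 := (hmain.const_mul c).add h2
  have e : c * (∫ y, f y * (-v)) + 0 = -(v * (c * ∫ y, f y)) := by
    rw [integral_mul_const]; ring
  rw [e] at h3
  refine h3.congr' ?_
  filter_upwards [eventually_gt_atTop 0] with R hR
  have e2 : ∫ y, f y * (G (R⁻¹ • y) / Real.log R) = (∫ y, f y * G (R⁻¹ • y)) / Real.log R := by
    rw [← integral_div]
    congr 1; ext y
    rw [mul_div_assoc]
  rw [setIntegral_comp_smul_logPotential hn hf hfc hu q ρ hR, e2]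
  ring

/-- Integrability of `w e^{nu}`, with `w` of order `d` in a cone, forces `u` to decay. -/
theorem add_le_of_integrable_weight (hn : 2 ≤ n) {f u w : Euc n → ℝ} {c C : ℝ}
    (hf : Integrable f) (hfc : Continuous f) (huc : Continuous u)
    (hu : ∀ x, u x = c * (∫ y, logKernel x y * f y) + C) (hw0 : ∀ x, 0 ≤ w x)
    (hi : Integrable fun x => w x * Real.exp (n * u x)) {q : Euc n} {ρ κ : ℝ} {d : ℕ} (hρ : 0 < ρ)
    (hκ : 0 < κ) (hw : ∀ᶠ R : ℝ in atTop, ∀ z ∈ closedBall q ρ, κ * R ^ d ≤ w (R • z)) :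
    (n + d : ℝ) ≤ n * (c * ∫ y, f y) := by
  have ht := tendsto_average_div_log hn hf hfc hu q ρ
  set B := closedBall q ρ with hBdef
  have hB : MeasurableSet B := measurableSet_closedBall
  set v := volume.real B with hv
  have hvol0 : volume B ≠ 0 := (measure_closedBall_pos _ q hρ).ne'
  have hvolt : volume B ≠ ⊤ := measure_closedBall_lt_top.ne
  have hv0 : 0 < v := ENNReal.toReal_pos hvol0 hvolt
  set T := ∫ x, w x * Real.exp (n * u x) with hT
  have hbound : ∀ᶠ R : ℝ in atTop,
      κ * v * R ^ (n + d) * Real.exp (n * ((∫ z in B, u (R • z)) / v)) ≤ T := by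
    filter_upwards [hw, eventually_gt_atTop 0] with R hR hR0
    have hRn : (0 : ℝ) < R ^ n := by positivity
    have hscale : R ^ n * ∫ z, w (R • z) * Real.exp (n * u (R • z)) = T := by
      rw [Measure.integral_comp_smul_of_nonneg volume
        (fun x => w x * Real.exp (n * u x)) R (hR := hR0.le), finrank_euclideanSpace_fin,
        smul_eq_mul, mul_inv_cancel_left₀ hRn.ne']
    have hiR : Integrable fun z => w (R • z) * Real.exp (n * u (R • z)) :=
      hi.comp_smul hR0.ne'
    have hucR : Continuous fun z => (n : ℝ) * u (R • z) :=
      continuous_const.mul (huc.comp (continuous_const_smul R))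
    have hBc : IsCompact B := isCompact_closedBall q ρ
    have hui : IntegrableOn (fun z => (n : ℝ) * u (R • z)) B :=
      hucR.continuousOn.integrableOn_compact hBc
    have hei : IntegrableOn (fun z => Real.exp ((n : ℝ) * u (R • z))) B :=
      (Real.continuous_exp.comp hucR).continuousOn.integrableOn_compact hBc
    -- Jensen: the average of `n u` over the ball bounds the average of `e^{nu}` from below.
    have hJ := convexOn_exp.map_set_average_le Real.continuous_exp.continuousOn isClosed_univ
      hvol0 hvolt (ae_of_all _ fun _ => Set.mem_univ _) hui hei
    rw [setAverage_eq, setAverage_eq, ← hv, smul_eq_mul, smul_eq_mul, integral_const_mul] at hJ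
    have h1 : ∫ z in B, κ * R ^ d * Real.exp ((n : ℝ) * u (R • z)) ≤
        ∫ z, w (R • z) * Real.exp (n * u (R • z)) := by
      refine le_trans (setIntegral_mono_on (hei.const_mul _) hiR.integrableOn hB fun z hz => ?_)
        (setIntegral_le_integral hiR (ae_of_all _ fun z => ?_))
      · exact mul_le_mul_of_nonneg_right (hR z hz) (Real.exp_pos _).le
      · exact mul_nonneg (hw0 _) (Real.exp_pos _).le
    rw [integral_const_mul] at h1
    have e : (n : ℝ) * ((∫ z in B, u (R • z)) / v) = v⁻¹ * (n * ∫ z in B, u (R • z)) := by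
      field_simp
    rw [← hscale, e]
    calc _ ≤ κ * v * R ^ (n + d) * (v⁻¹ * ∫ z in B, Real.exp ((n : ℝ) * u (R • z))) := by gcongr
      _ = R ^ n * (κ * R ^ d * ∫ z in B, Real.exp ((n : ℝ) * u (R • z))) := by
          rw [pow_add]; field_simp
      _ ≤ _ := by gcongr
  -- Taking logarithms and dividing by `log R` leaves only the exponent `n + d` and the limiting
  -- average.
  have hlogb : ∀ᶠ R : ℝ in atTop, Real.log (κ * v) / Real.log R + (n + d) +
      n * ((∫ z in B, u (R • z)) / Real.log R / v) ≤ Real.log T / Real.log R := by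
    filter_upwards [hbound, eventually_gt_atTop 1] with R hR hR1
    have hR0 : 0 < R := by linarith
    have hl : 0 < Real.log R := Real.log_pos hR1
    have h1 := Real.log_le_log (by positivity) hR
    rw [Real.log_mul (by positivity) (Real.exp_ne_zero _), Real.log_exp,
      Real.log_mul (by positivity) (by positivity), Real.log_pow] at h1
    rw [le_div_iff₀ hl]
    refine le_trans (le_of_eq ?_) h1
    push_cast
    field_simp
  have hlt := Real.tendsto_log_atTop
  have t1 : Tendsto (fun R : ℝ => Real.log (κ * v) / Real.log R + (n + d) +
      n * ((∫ z in B, u (R • z)) / Real.log R / v)) atTop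
      (𝓝 (0 + (n + d) + n * (-(v * (c * ∫ y, f y)) / v))) :=
    ((tendsto_const_nhds.div_atTop hlt).add_const _).add ((ht.div_const v).const_mul _)
  have t2 : Tendsto (fun R : ℝ => Real.log T / Real.log R) atTop (𝓝 0) :=
    tendsto_const_nhds.div_atTop hlt
  have := le_of_tendsto_of_tendsto t1 t2 hlogb
  rw [neg_div, mul_div_cancel_left₀ _ hv0.ne'] at this
  linarith

/-! ### Polynomial functions and centres of subhomogeneity. -/

lemma contDiff_polyFun (p : MvPolynomial (Fin n) ℝ) {k : ℕ∞ω} : ContDiff ℝ k (polyFun p) := by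
  induction p using MvPolynomial.induction_on with
  | C a =>
    have : polyFun (MvPolynomial.C a : MvPolynomial (Fin n) ℝ) = fun _ => a := by
      ext x; simp [polyFun]
    rw [this]; exact contDiff_const
  | add p q hp hq =>
    have : polyFun (p + q) = fun x => polyFun p x + polyFun q x := by ext x; simp [polyFun]
    rw [this]; exact hp.add hq
  | mul_X p i hp =>
    have : polyFun (p * MvPolynomial.X i) = fun x => polyFun p x * x i := by ext x; simp [polyFun]
    rw [this]; exact hp.mul (EuclideanSpace.proj (𝕜 := ℝ) i).contDiff

lemma polyFun_eq_zero {p : MvPolynomial (Fin n) ℝ} (h : ∀ x, polyFun p x = 0) : p = 0 := by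
  refine MvPolynomial.funext fun x => ?_
  simpa [polyFun] using h (WithLp.toLp 2 x)

/-- If `L` is the linear part of `T`, the chain rule gives `x · ∇(φ ∘ T)(x) = Dφ(T x)(L x)`, and `L
x = T x - T 0`; the centre is `T 0`. -/
lemma HomogeneityCondition.exists_center {φ : MvPolynomial (Fin n) ℝ}
    (h : HomogeneityCondition φ) :
    ∃ p : Euc n, ∀ z, (φ.totalDegree : ℝ) * polyFun φ z ≤ fderiv ℝ (polyFun φ) z (z - p) := by
  obtain ⟨T, hT⟩ := h
  have hTa : ∀ x, T x = T.linearIsometryEquiv x + T 0 := fun x => by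
    simpa using T.map_vadd 0 x
  refine ⟨T 0, fun z => ?_⟩
  obtain ⟨x, rfl⟩ := T.surjective z
  have h1 := hT x
  have hTd : HasFDerivAt (fun z => T z)
      (T.linearIsometryEquiv.toContinuousLinearEquiv : Euc n →L[ℝ] Euc n) x := by
    have := (T.linearIsometryEquiv.toContinuousLinearEquiv :
      Euc n →L[ℝ] Euc n).hasFDerivAt (x := x) |>.add_const (T 0)
    refine this.congr_of_eventuallyEq (Eventually.of_forall fun z => ?_)
    exact hTa z
  have hd := (((contDiff_polyFun φ (k := 1)).differentiable one_ne_zero (T x)).hasFDerivAt.comp x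
    hTd).fderiv
  have hg : inner ℝ x (∇ (fun z => polyFun φ (T z)) x) =
      fderiv ℝ (polyFun φ) (T x) (T.linearIsometryEquiv x) := by
    rw [real_inner_comm, gradient, InnerProductSpace.toDual_symm_apply]
    exact congrArg (fun L : Euc n →L[ℝ] ℝ => L x) hd
  rw [hg] at h1
  have h2 : T x - T 0 = T.linearIsometryEquiv x := by rw [hTa x]; abel
  rw [h2]; exact h1

/-- A function of degree at most two, written through a linear map. -/
def IsQuadraticFun (f : Euc n → ℝ) : Prop :=
  ∃ (A : Euc n →ₗ[ℝ] Euc n) (b : Euc n) (c : ℝ), ∀ x, f x = inner ℝ (A x) x + inner ℝ b x + c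

lemma isQuadraticFun_monomial {m : Fin n →₀ ℕ} (hm : m.degree ≤ 2) (a : ℝ) :
    IsQuadraticFun fun x : Euc n => a * ∏ i, x i ^ m i := by
  by_cases h0 : m = 0
  · exact ⟨0, 0, a, fun x => by simp [h0]⟩
  obtain ⟨i, hi⟩ := Finsupp.ne_iff.1 h0
  have hi' : Finsupp.single i 1 ≤ m := by
    rw [Finsupp.single_le_iff]; exact Nat.one_le_iff_ne_zero.2 hi
  obtain ⟨m', rfl⟩ := exists_add_of_le hi'
  have hs : ∀ (j : Fin n) (x : Euc n), ∏ k, x k ^ (Finsupp.single j 1 : Fin n →₀ ℕ) k = x j := by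
    intro j x
    rw [Finset.prod_eq_single j] <;> simp +contextual [eq_comm]
  have hadd : ∀ (m₁ m₂ : Fin n →₀ ℕ) (x : Euc n),
      ∏ k, x k ^ (m₁ + m₂) k = (∏ k, x k ^ m₁ k) * ∏ k, x k ^ m₂ k := by
    intro m₁ m₂ x
    simp [pow_add, Finset.prod_mul_distrib]
  rw [map_add, Finsupp.degree_single] at hm
  by_cases h1 : m' = 0
  · refine ⟨0, a • EuclideanSpace.single i 1, 0, fun x => ?_⟩
    beta_reduce
    rw [hadd, hs, h1]
    simp [inner_smul_left, EuclideanSpace.inner_single_left]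
  obtain ⟨j, hj⟩ := Finsupp.ne_iff.1 h1
  have hj' : Finsupp.single j 1 ≤ m' := by
    rw [Finsupp.single_le_iff]; exact Nat.one_le_iff_ne_zero.2 hj
  obtain ⟨m'', rfl⟩ := exists_add_of_le hj'
  rw [map_add, Finsupp.degree_single] at hm
  have h2 : m'' = 0 := by
    rw [← Finsupp.degree_eq_zero_iff]; omega
  refine ⟨((EuclideanSpace.proj (𝕜 := ℝ) j : Euc n →L[ℝ] ℝ) : Euc n →ₗ[ℝ] ℝ).smulRight
    (a • EuclideanSpace.single i 1), 0, 0, fun x => ?_⟩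
  beta_reduce
  rw [hadd, hadd, hs, hs, h2]
  simp [inner_smul_left, EuclideanSpace.inner_single_left]
  ring

lemma isQuadraticFun_polyFun {p : MvPolynomial (Fin n) ℝ} (hp : p.totalDegree ≤ 2) :
    IsQuadraticFun (polyFun p) := by
  have h : polyFun p = ∑ m ∈ p.support, fun x : Euc n => p.coeff m * ∏ i, x i ^ m i := by
    ext x
    rw [Finset.sum_apply, polyFun, MvPolynomial.eval_eq']
  rw [h]
  refine Finset.sum_induction _ IsQuadraticFun ?_ ⟨0, 0, 0, fun x => by simp⟩ fun m hm => ?_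
  · rintro f g ⟨A, b, c, hf⟩ ⟨A', b', c', hg⟩
    refine ⟨A + A', b + b', c + c', fun x => ?_⟩
    simp only [Pi.add_apply, hf, hg, LinearMap.add_apply, inner_add_left]; ring
  · refine isQuadraticFun_monomial ?_ _
    have := MvPolynomial.le_totalDegree hm
    rw [Finsupp.degree_eq_sum]
    rw [Finsupp.sum_fintype _ _ fun _ => rfl] at this
    exact this.trans hp

/-- A nonpositive quadratic function has a critical point, and it is a centre of
subhomogeneity. -/
lemma IsQuadraticFun.exists_center {f : Euc n → ℝ} (hf : IsQuadraticFun f) (h0 : ∀ x, f x ≤ 0) :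
    ∃ p : Euc n, ∀ z, 2 * f z ≤ fderiv ℝ f z (z - p) := by
  obtain ⟨A, b, c, hA⟩ := hf
  set S : Euc n →ₗ[ℝ] Euc n := A + LinearMap.adjoint A with hS
  have hSi : ∀ x y, inner ℝ (S x) y = inner ℝ (A x) y + inner ℝ (A y) x := fun x y => by
    rw [hS, LinearMap.add_apply, inner_add_left, LinearMap.adjoint_inner_left, real_inner_comm x]
  have hsym : S.IsSymmetric := fun x y => by
    rw [← real_inner_comm x (S y), hSi, hSi]; ring
  -- Along a line through the origin in the kernel of `S` the function is affine, and being
  -- nonpositive it has zero slope. Hence `b` is orthogonal to the kernel of the symmetric map `S`,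
  -- so `b = S p'`, and `-p'` is a critical point.
  have hker : b ∈ S.kerᗮ := by
    rw [Submodule.mem_orthogonal]
    intro x hx
    have hAx : inner ℝ (A x) x = 0 := by
      have := hSi x x
      rw [LinearMap.mem_ker.1 hx, inner_zero_left] at this
      linarith
    have hs : ∀ s : ℝ, s * inner ℝ b x + c ≤ 0 := fun s => by
      have := h0 (s • x)
      rw [hA, map_smul, inner_smul_left, inner_smul_right, inner_smul_right, hAx] at this
      simpa using this
    rw [real_inner_comm]
    by_contra hne
    -- This parameter makes the affine function equal to 1.
    have := hs ((1 - c) / inner ℝ b x)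
    rw [div_mul_cancel₀ _ hne] at this
    linarith
  rw [← hsym.orthogonal_range, Submodule.orthogonal_orthogonal] at hker
  obtain ⟨p', hp'⟩ := hker
  refine ⟨-p', fun z => ?_⟩
  have hd : HasFDerivAt f (innerSL ℝ (S z) + innerSL ℝ b) z := by
    have hAc : HasFDerivAt (fun x => A x) (LinearMap.toContinuousLinearMap A) z :=
      (LinearMap.toContinuousLinearMap A).hasFDerivAt
    have h1 := ((hAc.inner ℝ (hasFDerivAt_id z)).add (innerSL ℝ b).hasFDerivAt).add_const c
    have hfe : f = fun x => inner ℝ (A x) (id x) + innerSL ℝ b x + c := funext hA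
    rw [hfe]
    convert! h1 using 1
    ext v
    simp [hSi]
  -- By completing the square, `Df(z)(z + p') = 2 (f z - f (-p'))`, so the claim is just `f (-p') ≤
  -- 0`.
  have h1 := h0 (-p')
  rw [hd.fderiv]
  have e : ∀ x, 2 * f x = inner ℝ (S x) x + 2 * inner ℝ (S p') x + 2 * c := fun x => by
    rw [hA, hSi, hp']; ring
  have e2 : inner ℝ (S p') z = inner ℝ (S z) p' := by
    rw [hsym p' z, real_inner_comm]
  have e3 := e z
  have e4 := e (-p')
  rw [map_neg, inner_neg_left, inner_neg_right] at e4
  simp only [_root_.add_apply, innerSL_apply_apply, sub_neg_eq_add, inner_add_right,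
    ← hp']
  linarith

/-! ### Leading forms of nonpositive polynomials. -/

lemma polyFun_smul_of_isHomogeneous {p : MvPolynomial (Fin n) ℝ} {d : ℕ} (hp : p.IsHomogeneous d)
    (r : ℝ) (x : Euc n) : polyFun p (r • x) = r ^ d * polyFun p x := by
  rw [polyFun, polyFun, MvPolynomial.eval_eq', MvPolynomial.eval_eq', Finset.mul_sum]
  refine Finset.sum_congr rfl fun m hm => ?_
  have h1 := hp.degree_eq_sum_deg_support hm
  simp only [PiLp.smul_apply, smul_eq_mul, mul_pow, Finset.prod_mul_distrib,
    Finset.prod_pow_eq_pow_sum]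
  have h2 : ∑ i, m i = d := by
    rw [h1]
    exact (Finset.sum_subset (Finset.subset_univ _) fun i _ hi => by simpa using hi).symm
  rw [h2]; ring

lemma polyFun_smul (p : MvPolynomial (Fin n) ℝ) (r : ℝ) (x : Euc n) :
    polyFun p (r • x) = ∑ i ∈ Finset.range (p.totalDegree + 1),
      r ^ i * polyFun (MvPolynomial.homogeneousComponent i p) x := by
  have h : polyFun p (r • x) = ∑ i ∈ Finset.range (p.totalDegree + 1),
      polyFun (MvPolynomial.homogeneousComponent i p) (r • x) := by
    conv_lhs => rw [← MvPolynomial.sum_homogeneousComponent p]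
    simp only [polyFun, map_sum]
  rw [h]
  exact Finset.sum_congr rfl fun i _ => polyFun_smul_of_isHomogeneous
    (MvPolynomial.homogeneousComponent_isHomogeneous i p) r x

/-- The leading form approximates a polynomial along dilations, uniformly on balls. -/
lemma exists_abs_polyFun_smul_sub_le {p : MvPolynomial (Fin n) ℝ} {e : ℕ}
    (hp : p.totalDegree = e + 1) (q : Euc n) (ρ : ℝ) :
    ∃ M : ℝ, ∀ R : ℝ, 1 ≤ R → ∀ z ∈ closedBall q ρ,
      |polyFun p (R • z) - R ^ (e + 1) *
        polyFun (MvPolynomial.homogeneousComponent (e + 1) p) z| ≤ M * R ^ e := by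
  have hb : ∀ i : ℕ, ∃ M, ∀ z ∈ closedBall q ρ,
      ‖polyFun (MvPolynomial.homogeneousComponent i p) z‖ ≤ M := fun i =>
    (isCompact_closedBall q ρ).exists_bound_of_continuousOn
      (contDiff_polyFun _ (k := 0)).continuous.continuousOn
  choose M hM using hb
  refine ⟨∑ i ∈ Finset.range (e + 1), |M i|, fun R hR z hz => ?_⟩
  rw [polyFun_smul, hp, Finset.sum_range_succ, add_sub_cancel_right, Finset.sum_mul]
  refine (Finset.abs_sum_le_sum_abs _ _).trans (Finset.sum_le_sum fun i hi => ?_)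
  rw [abs_mul, abs_of_nonneg (by positivity : (0 : ℝ) ≤ R ^ i), mul_comm]
  have h1 : R ^ i ≤ R ^ e := pow_le_pow_right₀ hR (Nat.lt_succ_iff.1 (Finset.mem_range.1 hi))
  exact mul_le_mul ((hM i z hz).trans (le_abs_self _)) h1 (by positivity) (abs_nonneg _)

lemma eventually_mul_pow_le (M : ℝ) {κ : ℝ} (hκ : 0 < κ) (e : ℕ) :
    ∀ᶠ R : ℝ in atTop, M * R ^ e ≤ κ * R ^ (e + 1) := by
  filter_upwards [eventually_ge_atTop (M / κ), eventually_ge_atTop 0] with R h1 h0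
  rw [div_le_iff₀ hκ] at h1
  calc M * R ^ e ≤ (R * κ) * R ^ e := by gcongr
    _ = κ * R ^ (e + 1) := by ring

section Nonpos

variable {φ : MvPolynomial (Fin n) ℝ}

lemma leadingForm_nonpos (h0 : ∀ x : Euc n, polyFun φ x ≤ 0) {e : ℕ}
    (he : φ.totalDegree = e + 1) (x : Euc n) :
    polyFun (MvPolynomial.homogeneousComponent (e + 1) φ) x ≤ 0 := by
  by_contra! hpos
  -- Radius zero: only the ray through `x` matters, along which a positive leading form would make
  -- `φ` positive.
  obtain ⟨M, hM⟩ := exists_abs_polyFun_smul_sub_le he x 0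
  obtain ⟨R, h1, h2⟩ := ((eventually_mul_pow_le M (half_pos hpos) e).and
    (eventually_ge_atTop 1)).exists
  have h3 := (abs_le.1 (hM R h2 x (by simp))).1
  have h4 := h0 (R • x)
  have h5 : 0 < R ^ (e + 1) * polyFun (MvPolynomial.homogeneousComponent (e + 1) φ) x := by
    positivity
  linarith

lemma leadingForm_ne_zero {e : ℕ} (he : φ.totalDegree = e + 1) :
    MvPolynomial.homogeneousComponent (e + 1) φ ≠ 0 := by
  have hφ : φ ≠ 0 := by rintro rfl; simp at he
  obtain ⟨m, hm, hdeg⟩ := Finset.exists_mem_eq_sup φ.support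
    (MvPolynomial.support_nonempty.2 hφ) (fun s => s.sum fun _ e => e)
  intro h
  have hc := congrArg (MvPolynomial.coeff m) h
  have hd : m.degree = e + 1 := by
    rw [← he, MvPolynomial.totalDegree, hdeg]; rfl
  rw [MvPolynomial.coeff_homogeneousComponent, if_pos hd, MvPolynomial.coeff_zero] at hc
  exact MvPolynomial.mem_support_iff.1 hm hc

/-- An odd leading form changes sign under `x ↦ -x`; being nonpositive everywhere it would vanish.
-/
lemma even_totalDegree_of_nonpos (h0 : ∀ x : Euc n, polyFun φ x ≤ 0) : Even φ.totalDegree := by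
  rcases h : φ.totalDegree with _ | e
  · exact Even.zero
  by_contra hodd
  rw [Nat.not_even_iff_odd] at hodd
  refine leadingForm_ne_zero h (polyFun_eq_zero fun x => ?_)
  have h1 := leadingForm_nonpos h0 h x
  have h2 := leadingForm_nonpos h0 h ((-1 : ℝ) • x)
  rw [polyFun_smul_of_isHomogeneous (MvPolynomial.homogeneousComponent_isHomogeneous _ φ),
    hodd.neg_one_pow] at h2
  linarith

lemma exists_ball_neg_polyFun_ge (h0 : ∀ x : Euc n, polyFun φ x ≤ 0)
    (hd : φ.totalDegree ≠ 0) : ∃ (q : Euc n) (ρ κ : ℝ), 0 < ρ ∧ 0 < κ ∧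
      ∀ᶠ R : ℝ in atTop, ∀ z ∈ closedBall q ρ, κ * R ^ φ.totalDegree ≤ -polyFun φ (R • z) := by
  obtain ⟨e, he⟩ := Nat.exists_eq_succ_of_ne_zero hd
  rw [Nat.succ_eq_add_one] at he
  set h := MvPolynomial.homogeneousComponent (e + 1) φ with hh
  obtain ⟨q, hq⟩ : ∃ q : Euc n, polyFun h q ≠ 0 := by
    by_contra! hall
    exact leadingForm_ne_zero he (polyFun_eq_zero hall)
  have hq' : polyFun h q < 0 := lt_of_le_of_ne (leadingForm_nonpos h0 he q) hq
  have hc : Continuous (polyFun h : Euc n → ℝ) := (contDiff_polyFun h (k := 0)).continuous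
  obtain ⟨ρ, hρ, hball⟩ := nhds_basis_closedBall.mem_iff.1
    (hc.continuousAt.eventually_lt_const (by linarith : polyFun h q < polyFun h q / 2))
  obtain ⟨M, hM⟩ := exists_abs_polyFun_smul_sub_le he q ρ
  -- On the ball the leading form is below half its value at `q`; a quarter absorbs the lower-order
  -- terms and a quarter remains as `κ`.
  refine ⟨q, ρ, -polyFun h q / 4, hρ, by linarith, ?_⟩
  filter_upwards [eventually_mul_pow_le M (κ := -polyFun h q / 4) (by linarith) e,
    eventually_ge_atTop 1] with R h1 h2 z hz
  have h3 := (abs_le.1 (hM R h2 z hz)).2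
  have h4 : polyFun h z < polyFun h q / 2 := hball hz
  have h5 : R ^ (e + 1) * polyFun h z ≤ R ^ (e + 1) * (polyFun h q / 2) := by gcongr
  rw [he]
  linarith

end Nonpos

/-- A nonpositive polynomial of degree at most `n - 2` satisfying the hypothesis in the
intermediate range of degrees is subhomogeneous about some centre. -/
lemma exists_center {φ : MvPolynomial (Fin n) ℝ} (h0 : ∀ x : Euc n, polyFun φ x ≤ 0)
    (hd : φ.totalDegree ≤ n - 2)
    (hφ : 4 ≤ φ.totalDegree → φ.totalDegree ≤ n - 2 → HomogeneityCondition φ) :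
    ∃ p : Euc n, ∀ z, (φ.totalDegree : ℝ) * polyFun φ z ≤ fderiv ℝ (polyFun φ) z (z - p) := by
  rcases le_or_gt 4 φ.totalDegree with h4 | h4
  · exact (hφ h4 hd).exists_center
  have heven := even_totalDegree_of_nonpos h0
  have hcases : φ.totalDegree = 0 ∨ φ.totalDegree = 2 := by
    obtain ⟨k, hk⟩ := heven
    omega
  rcases hcases with h | h
  · refine ⟨0, fun z => ?_⟩
    rw [MvPolynomial.totalDegree_eq_zero_iff_eq_C] at h
    have hc : polyFun φ = fun _ : Euc n => φ.coeff 0 := by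
      ext x; rw [h]; simp [polyFun]
    have h' : φ.totalDegree = 0 := MvPolynomial.totalDegree_eq_zero_iff_eq_C.2 h
    rw [h', hc]; simp
  · rw [h]
    exact (isQuadraticFun_polyFun h.le).exists_center h0

/-! ### Comparison of volumes. -/

lemma sphereVol_ne_top (n : ℕ) : sphereVol n ≠ ⊤ := measure_ne_top _ _

lemma sphereVol_ne_zero (n : ℕ) : sphereVol n ≠ 0 := by
  rw [sphereVol, Measure.toSphere_apply_univ, finrank_euclideanSpace_fin]
  exact mul_ne_zero (by simp) (measure_ball_pos _ _ one_pos).ne'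

/-- The comparison of volumes, in terms of `t = Λ / Λ₁`: `Λ = F V + P`, with `P ≤ 0`, the decay
bound `n + d ≤ 2 n t` and the Pohozaev inequality. -/
lemma volume_comparison {n d F S V P t : ℝ} (hn : 0 < n) (hd : 0 ≤ d) (hF : 0 < F) (hS : 0 < S)
    (hP : P ≤ 0) (hΛ : t * (F * S) = F * V + P) (hdecay : n + d ≤ 2 * n * t)
    (hpoh : d < n → d * P ≤ n * (F * S) * (t * (t - 1))) :
    S ≤ V ∧ (V = S → P = 0) := by
  rcases le_or_gt 1 t with ht | ht
  · have h1 : F * S ≤ t * (F * S) := le_mul_of_one_le_left (by positivity) ht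
    have h2 : F * S ≤ F * V := by linarith
    refine ⟨le_of_mul_le_mul_left h2 hF, fun h => ?_⟩
    subst h
    linarith
  · have hdn : d < n := by nlinarith
    have hp := hpoh hdn
    have ht2 : 1 / 2 ≤ t := by nlinarith
    have hFS : 0 < F * S := by positivity
    have hneg : t * (t - 1) < 0 := mul_neg_of_pos_of_neg (by linarith) (by linarith)
    -- For `d = 0` the Pohozaev inequality would read `0 ≤ n F S t (t - 1) < 0`.
    have hd0 : 0 < d := by
      rcases hd.eq_or_lt with h | h
      · rw [← h, zero_mul] at hp
        have : n * (F * S) * (t * (t - 1)) < 0 := mul_neg_of_pos_of_neg (by positivity) hneg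
        linarith
      · exact h
    have hlt : F * S < F * V := by
      have h1 : d * (F * V) ≥ d * (t * (F * S)) - n * (F * S) * (t * (t - 1)) := by
        have : F * V = t * (F * S) - P := by linarith
        rw [this]; linarith
      -- Here `nt ≥ (n + d) / 2 > d`. Multiplied by `F S`, this product bounds `d (F V - F S)` from
      -- below.
      have h2 : 0 < (1 - t) * (n * t - d) := mul_pos (by linarith) (by nlinarith)
      have h3 : d * (F * S) < d * (F * V) := by nlinarith [mul_pos hFS h2]
      exact lt_of_mul_lt_mul_left h3 hd
    have h4 : S < V := lt_of_mul_lt_mul_left hlt hF.le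
    exact ⟨h4.le, fun h => absurd h h4.ne'⟩

end QCurvature

open QCurvature in
theorem volume_bounds_of_integrable {n : ℕ} (hn : 6 ≤ n) (hn_even : Even n)
    {φ : MvPolynomial (Fin n) ℝ} (h0 : ∀ x : Euc n, polyFun φ x ≤ 0)
    (hφ : 4 ≤ φ.totalDegree → φ.totalDegree ≤ n - 2 → HomogeneityCondition φ) {u : Euc n → ℝ}
    (hu : IsNormalSolution n (fun x => (Nat.factorial (n - 1) : ℝ) + polyFun φ x) u)
    (hV : Integrable fun x => Real.exp (n * u x)) :
    (sphereVol n).toReal ≤ ∫ x, Real.exp (n * u x) ∧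
      (∫ x, Real.exp (n * u x) = (sphereVol n).toReal ↔ φ = 0) := by
  have hn2 : 2 ≤ n := by omega
  have hnpos : (0 : ℝ) < n := by exact_mod_cast (by omega : 0 < n)
  have hSpos : 0 < (sphereVol n).toReal :=
    ENNReal.toReal_pos (sphereVol_ne_zero n) (sphereVol_ne_top n)
  have hFpos : (0 : ℝ) < (Nat.factorial (n - 1) : ℝ) := by exact_mod_cast Nat.factorial_pos _
  obtain ⟨C, hC⟩ := hu.normal
  have hQ : ContDiff ℝ 1 fun x : Euc n => (Nat.factorial (n - 1) : ℝ) + polyFun φ x :=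
    hu.smooth_curvature.of_le (by simp)
  have hu1 : ContDiff ℝ 1 u := hu.smooth.of_le (by simp)
  have hf := hu.integrable
  have hfc : Continuous fun x => ((Nat.factorial (n - 1) : ℝ) + polyFun φ x) *
      Real.exp (n * u x) :=
    hQ.continuous.mul (Real.continuous_exp.comp (continuous_const.mul hu1.continuous))
  have hpi : Integrable fun x => polyFun φ x * Real.exp (n * u x) := by
    refine (hf.sub (hV.const_mul (Nat.factorial (n - 1) : ℝ))).congr
      (Filter.Eventually.of_forall fun x => ?_)
    simp only [Pi.sub_apply]; ring
  have hsum : ∫ x, ((Nat.factorial (n - 1) : ℝ) + polyFun φ x) * Real.exp (n * u x) =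
      (Nat.factorial (n - 1) : ℝ) * (∫ x, Real.exp (n * u x)) +
        ∫ x, polyFun φ x * Real.exp (n * u x) := by
    simp only [add_mul]
    rw [integral_add (hV.const_mul _) hpi, integral_const_mul]
  have hderiv : ∀ x, fderiv ℝ (fun x : Euc n => (Nat.factorial (n - 1) : ℝ) + polyFun φ x) x =
      fderiv ℝ (polyFun φ) x := fun x => by rw [fderiv_const_add]
  have hP : ∫ x, polyFun φ x * Real.exp (n * u x) ≤ 0 :=
    integral_nonpos fun x => mul_nonpos_of_nonpos_of_nonneg (h0 x) (Real.exp_pos _).le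
  have hP0 : ∫ x, polyFun φ x * Real.exp (n * u x) = 0 → φ = 0 := fun h => by
    refine polyFun_eq_zero fun x => ?_
    have hcont : Continuous fun x => -(polyFun φ x * Real.exp (n * u x)) :=
      ((contDiff_polyFun φ (k := 0)).continuous.mul
        (Real.continuous_exp.comp (continuous_const.mul hu1.continuous))).neg
    have hz : ∫ x, -(polyFun φ x * Real.exp (n * u x)) = 0 := by rw [integral_neg, h, neg_zero]
    have h2 := (integral_eq_zero_iff_of_nonneg (fun x => neg_nonneg.2
      (mul_nonpos_of_nonpos_of_nonneg (h0 x) (Real.exp_pos _).le)) hpi.neg).1 hz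
    have h3 := congrFun ((Continuous.ae_eq_iff_eq volume hcont continuous_const).1 h2) x
    have h4 : polyFun φ x * Real.exp (n * u x) = 0 := neg_eq_zero.1 h3
    exact (mul_eq_zero.1 h4).resolve_right (Real.exp_ne_zero _)
  have hdecay : (n + φ.totalDegree : ℝ) ≤
      n * (2 / ((Nat.factorial (n - 1) : ℝ) * (sphereVol n).toReal) *
        ∫ x, ((Nat.factorial (n - 1) : ℝ) + polyFun φ x) * Real.exp (n * u x)) := by
    -- In degree zero the weight is 1 and finite volume is what forces decay; otherwise the weight
    -- is `-φ`, of order `deg φ` in a cone.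
    by_cases hd : φ.totalDegree = 0
    · refine add_le_of_integrable_weight hn2 hf hfc hu1.continuous hC (w := fun _ => 1) (q := 0)
        (ρ := 1) (κ := 1) (fun _ => zero_le_one) (by simpa using hV) one_pos one_pos ?_
      exact Filter.Eventually.of_forall fun R z _ => by simp [hd]
    · obtain ⟨q, ρ, κ, hρ, hκ, hw⟩ := exists_ball_neg_polyFun_ge h0 hd
      refine add_le_of_integrable_weight hn2 hf hfc hu1.continuous hC
        (w := fun x => -polyFun φ x) (fun x => neg_nonneg.2 (h0 x)) ?_ hρ hκ hw
      simpa using hpi.neg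
  have hpoh : ∀ {p : Euc n} {ℓ : Euc n → ℝ}, (∀ z, ℓ z ≤ fderiv ℝ (polyFun φ) z (z - p)) →
      (Integrable fun x => ℓ x * Real.exp (n * u x)) → _ := fun {p ℓ} h hi =>
    pohozaev_le hn2 (p := p) (ℓ := ℓ) hQ hu1 hf hC (fun x => by rw [hderiv]; exact h x) hi
  have hpoh0 : φ = 0 → _ := fun h => tendsto_pohozaev hn2 hQ hu1 hf hC 0
  simp only [hderiv] at hpoh0
  set F : ℝ := (Nat.factorial (n - 1) : ℝ)
  set S := (sphereVol n).toReal
  set V := ∫ x, Real.exp (n * u x)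
  set P := ∫ x, polyFun φ x * Real.exp (n * u x) with hPdef
  rw [hsum] at hdecay hpoh hpoh0
  set Λ := F * V + P with hΛ
  set t := Λ / (F * S) with ht
  have htΛ : t * (F * S) = Λ := div_mul_cancel₀ _ (by positivity)
  have hform : n * (2 / (F * S)) * Λ ^ 2 - 2 * (n * Λ) = 2 * (n * (F * S) * (t * (t - 1))) := by
    rw [← htΛ]; field_simp
  have hdecay' : (n + φ.totalDegree : ℝ) ≤ 2 * n * t := by
    refine hdecay.trans (le_of_eq ?_)
    rw [ht]; ring
  obtain ⟨hle, heq⟩ := volume_comparison (n := (n : ℝ)) (d := φ.totalDegree) (F := F) (S := S)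
    (V := V) (P := P) (t := t) hnpos (Nat.cast_nonneg _) hFpos hSpos hP htΛ hdecay' (fun hdn => by
      have hdn' : φ.totalDegree < n := by exact_mod_cast hdn
      have heven := even_totalDegree_of_nonpos h0
      -- Both `n` and the degree are even, so `d < n` improves to the range covered by the
      -- hypothesis.
      have hd2 : φ.totalDegree ≤ n - 2 := by
        obtain ⟨a, ha⟩ := heven
        obtain ⟨b, hb⟩ := hn_even
        omega
      obtain ⟨p, hp⟩ := exists_center h0 hd2 hφ
      have h1 := hpoh hp (by simpa only [mul_assoc] using hpi.const_mul (φ.totalDegree : ℝ))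
      rw [hform] at h1
      simp only [mul_assoc (φ.totalDegree : ℝ), integral_const_mul, ← hPdef] at h1
      linarith)
  refine ⟨hle, fun h => hP0 (heq h), fun h => ?_⟩
  have hlim := hpoh0 h
  rw [hform] at hlim
  have hpz : (polyFun φ : Euc n → ℝ) = fun _ => 0 := by ext x; simp [h, polyFun]
  have hPz : P = 0 := by rw [hPdef, hpz]; simp
  -- For `φ = 0` the curvature term vanishes for every cutoff, so the limit identity gives `t (t -
  -- 1) = 0`; decay excludes `t = 0`.
  have hz : 2 * (n * (F * S) * (t * (t - 1))) = 0 := by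
    refine tendsto_nhds_unique hlim ?_
    simp [hpz]
  have htpos : 0 < t := by
    have : (0 : ℝ) ≤ φ.totalDegree := Nat.cast_nonneg _
    by_contra! hneg
    nlinarith
  have ht1 : t = 1 := by
    have h3 : (2 * (n * (F * S))) * (t * (t - 1)) = 0 := by linarith
    have h4 := (mul_eq_zero.1 h3).resolve_left (by positivity)
    linarith [(mul_eq_zero.1 h4).resolve_left htpos.ne']
  rw [ht1, one_mul, hΛ, hPz, add_zero] at htΛ
  exact (mul_left_cancel₀ hFpos.ne' htΛ).symm

theorem theorem1p3 (n : ℕ) (hn : 6 ≤ n) (hn_even : Even n)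
    (φ : MvPolynomial (Fin n) ℝ)
    (hφ_nonpos : ∀ x : QCurvature.Euc n, QCurvature.polyFun φ x ≤ 0)
    (hφ_hom : 4 ≤ φ.totalDegree → φ.totalDegree ≤ n - 2 → QCurvature.HomogeneityCondition φ)
    (u : QCurvature.Euc n → ℝ)
    (hu : QCurvature.IsNormalSolution n (fun x => (Nat.factorial (n - 1) : ℝ) + QCurvature.polyFun φ x) u) :
    QCurvature.sphereVol n ≤ ∫⁻ x, ENNReal.ofReal (Real.exp (n * u x)) ∧
      (∫⁻ x, ENNReal.ofReal (Real.exp (n * u x)) = QCurvature.sphereVol n ↔ φ = 0) := by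
  have hexp : Continuous fun x => Real.exp (n * u x) :=
    Real.continuous_exp.comp (continuous_const.mul hu.smooth.continuous)
  have hnn : ∀ x, 0 ≤ Real.exp (n * u x) := fun x => (Real.exp_pos _).le
  have hiff : Integrable (fun x => Real.exp (n * u x)) ↔
      ∫⁻ x, ENNReal.ofReal (Real.exp (n * u x)) ≠ ⊤ :=
    (lintegral_ofReal_ne_top_iff_integrable hexp.aestronglyMeasurable
      (Filter.Eventually.of_forall hnn)).symm
  by_cases hV : Integrable fun x => Real.exp (n * u x)
  · rw [← ofReal_integral_eq_lintegral_ofReal hV (Filter.Eventually.of_forall hnn)]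
    obtain ⟨h1, h2⟩ := volume_bounds_of_integrable hn hn_even hφ_nonpos hφ_hom hu hV
    have hS := ENNReal.ofReal_toReal (QCurvature.sphereVol_ne_top n)
    have hV0 : 0 ≤ ∫ x, Real.exp (n * u x) := integral_nonneg hnn
    rw [← hS, ENNReal.ofReal_eq_ofReal_iff hV0 ENNReal.toReal_nonneg]
    exact ⟨ENNReal.ofReal_le_ofReal h1, h2⟩
  · have htop : ∫⁻ x, ENNReal.ofReal (Real.exp (n * u x)) = ⊤ := by
      by_contra h; exact hV (hiff.2 h)
    rw [htop]
    refine ⟨le_top, fun h => absurd h.symm (QCurvature.sphereVol_ne_top n), fun h => ?_⟩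
    have hF : (Nat.factorial (n - 1) : ℝ) ≠ 0 := by exact_mod_cast Nat.factorial_ne_zero _
    -- With `φ = 0` the curvature is a nonzero constant, so integrability of `Q e^{nu}` contradicts
    -- infinite volume.
    refine absurd ((hu.integrable.const_mul (Nat.factorial (n - 1) : ℝ)⁻¹).congr
      (Filter.Eventually.of_forall fun x => ?_)) hV
    simp [h, QCurvature.polyFun, hF]
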